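/- A flat affine manifold $(M,\nabla)$ is an $n$-dimensional (Hausdorff) smooth manifold with a flat torsion-free connection, equivalently with an atlas whose transition maps are locally affine; the charts of this atlas give the flat coordinates $x^1,\dots,x^n$. A Hessian metric is a smooth Riemannian metric $g$ that in flat coordinates is locally $\sum\frac{\partial^2\varphi}{\partial x^i\partial x^j}dx^i dx^j$ for a smooth function $\varphi$. A selfsimilar Hessian manifold $(M,\nabla,g,\xi)$ is a flat affine manifold with a Hessian metric $g$ and a smooth vector field $\xi$ whose local flow preserves $\nabla$ and such that $\mathcal L_\xi g=2g$. **Theorem.** Let $(M,\nabla,g,\xi)$ be a simply connected selfsimilar Hessian manifold whose field $\xi$ vanishes nowhere. Then there is a development map $\mathrm{dev}:M\to\mathbb R^n$, i.e. a map which in flat coordinates is locally an affine isomorphism. Fix any such map. It identifies $TM$ with $M\times\mathbb R^n$ by the diffeomorphism $v\mapsto(\pi(v),d\,\mathrm{dev}(v))$. On $M\times\mathbb R^n$, with projection $\pi$ to $M$ and with $T_{(m,v)}(M\times\mathbb R^n)=T_mM\times\mathbb R^n$ identified with $\mathbb R^n\times\mathbb R^n$ through $d\,\mathrm{dev}$,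 put $$I(X\times Y)=(-Y)\times X,\qquad g^{\mathrm r}(X,Y)=(\pi^*g)(X,Y)+(\pi^*g)(IX,IY),\qquad \omega(X,Y)=g^{\mathrm r}(IX,Y).$$ Under the above identification these correspond to the structures on $TM$ given in the coordinates $(x,y)$ induced by flat coordinates $x$ by $I\frac{\partial}{\partial x^i}=\frac{\partial}{\partial y^i}$ and $g^{\mathrm r}=\pi^*g_{ij}(dx^idx^j+dy^idy^j)$, and $(I,\omega)$ is a Kähler structure. Let $G$ be the group of affine isometries of $(M,\nabla,g)$ preserving $\xi$. There is an affine action $\theta$ of $G$ on $\mathbb R^n$ with $\mathrm{dev}(am)=\theta_a(\mathrm{dev}(m))$ for $a\in G$, $m\in M$. Let $G\ltimes_\theta\mathbb R^n$ be the semidirect product formed with the linear parts of $\theta$, acting on $M\times\mathbb R^n$ by $$(a\ltimes u)(m,v)=(am,\theta_a(v)+u),$$ and let $\omega_{c.K.}=\pi^*\big(g(\xi,\xi)^{-1}\big)\,\omega$. 1. $(I,\omega_{c.K.})$ is a (globally) conformally Kähler structure on $M\times\mathbb R^n$ (a positive smooth function times the form of a Kähler structure with complex structure $I$), and it is invariant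 under $G\ltimes_\theta\mathbb R^n$. 2. If $\xi$ is complete with flow $\rho_t$, then $(t,a)m=\rho_t(am)$ defines an action of $\mathbb R\times G$ on $M$, there is an affine action $\Theta$ of $\mathbb R\times G$ on $\mathbb R^n$ for which $\mathrm{dev}$ is equivariant, and $(I,\omega_{c.K.})$ is invariant under the action of $(\mathbb R\times G)\ltimes_\Theta\mathbb R^n$ on $M\times\mathbb R^n$ given by $(k\ltimes u)(m,v)=(km,\Theta_k(v)+u)$. 3. If $\xi$ is complete and $G$ acts transitively on $\{m\in M: g(\xi,\xi)(m)=1\}$, then $(M\times\mathbb R^n,I,\omega_{c.K.})$ is a homogeneous conformally Kähler manifold for $(\mathbb R\times G)\ltimes_\Theta\mathbb R^n$, i.e. this group acts transitively and preserves $(I,\omega_{c.K.})$. -/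

import Mathlib

open scoped Manifold ContDiff Topology
open Bundle

noncomputable section

namespace SelfsimilarHessian

/-- The model space `ℝⁿ`. -/
abbrev RSpace (n : ℕ) := EuclideanSpace ℝ (Fin n)

/-! ### Flat affine manifolds -/

/-- Affine maps of `ℝⁿ` are smooth. -/
lemma contDiff_affineMap {n : ℕ} (A : RSpace n →ᵃ[ℝ] RSpace n) :
    ContDiff ℝ ∞ (fun y : RSpace n => A y) := by
  have h : (fun y : RSpace n => A y) = fun y => A.linear.toContinuousLinearMap y + A 0 := by
    ext1 y
    exact congrFun A.decomp y
  rw [h]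
  exact A.linear.toContinuousLinearMap.contDiff.add contDiff_const

/-- A flat affine manifold: all transition maps between the charts of the atlas are, locally,
affine transformations of `ℝⁿ`. The flat torsion-free connection `∇` is the one whose flat
coordinates are the charts of this atlas. (A flat torsion-free connection is the same thing as such
an atlas, up to enlarging the atlas.) -/
class FlatAffineManifold (n : ℕ) (M : Type*) [TopologicalSpace M] [ChartedSpace (RSpace n) M] :
    Prop where
  affine_transition : ∀ e ∈ atlas (RSpace n) M, ∀ e' ∈ atlas (RSpace n) M,
    ∀ x ∈ (e.symm.trans e').source,
      ∃ A : RSpace n ≃ᵃ[ℝ] RSpace n, ∀ᶠ y in 𝓝 x, (e.symm.trans e') y = A y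

/-- A flat affine manifold is in particular a smooth manifold. -/
instance FlatAffineManifold.isManifold (n : ℕ) (M : Type*) [TopologicalSpace M]
    [ChartedSpace (RSpace n) M] [FlatAffineManifold n M] : IsManifold 𝓘(ℝ, RSpace n) ∞ M := by
  apply isManifold_of_contDiffOn
  intro e e' he he' x hx
  simp only [mfld_simps] at hx
  obtain ⟨A, hA⟩ := FlatAffineManifold.affine_transition e he e' he' x (by simpa using hx)
  have hs : ContDiff ℝ ∞ (fun y : RSpace n => A y) :=
    contDiff_affineMap A.toAffineMap
  refine (hs.contDiffAt.congr_of_eventuallyEq ?_).contDiffWithinAt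
  filter_upwards [hA] with y hy
  simpa using hy

section Affine

variable {n : ℕ} {M : Type*} [TopologicalSpace M] [ChartedSpace (RSpace n) M]

/-- `f : M → M` is, near `x`, an affine map in flat coordinates. -/
def IsAffineMapAt (n : ℕ) {M : Type*} [TopologicalSpace M] [ChartedSpace (RSpace n) M]
    (f : M → M) (x : M) : Prop :=
  ContinuousAt f x ∧ ∃ A : RSpace n →ᵃ[ℝ] RSpace n,
    ∀ᶠ y in 𝓝 x, chartAt (RSpace n) (f x) (f y) = A (chartAt (RSpace n) x y)

lemma IsAffineMapAt.comp {f h : M → M} {x : M} (hf : IsAffineMapAt n f (h x))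
    (hh : IsAffineMapAt n h x) : IsAffineMapAt n (f ∘ h) x := by
  obtain ⟨hf1, A, hA⟩ := hf
  obtain ⟨hh1, B, hB⟩ := hh
  refine ⟨hf1.comp hh1, A.comp B, ?_⟩
  filter_upwards [hB, hh1.eventually hA] with y hy hy'
  simp [hy', hy]

lemma IsAffineMapAt.mdifferentiableAt {f : M → M} {x : M} (hf : IsAffineMapAt n f x) :
    MDifferentiableAt 𝓘(ℝ, RSpace n) 𝓘(ℝ, RSpace n) f x := by
  obtain ⟨hc, A, hA⟩ := hf
  rw [mdifferentiableAt_iff]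
  refine ⟨hc, ?_⟩
  have hs : ContDiff ℝ ∞ (fun y : RSpace n => A y) := contDiff_affineMap A
  have hd : DifferentiableAt ℝ (fun y : RSpace n => A y) (chartAt (RSpace n) x x) :=
    (hs.differentiable (by simp)).differentiableAt
  refine (hd.congr_of_eventuallyEq ?_).differentiableWithinAt
  have ht : Filter.Tendsto (chartAt (RSpace n) x).symm (𝓝 (chartAt (RSpace n) x x)) (𝓝 x) := by
    have := (chartAt (RSpace n) x).symm.continuousAt
      ((chartAt (RSpace n) x).map_source (mem_chart_source _ x))
    rwa [ContinuousAt, (chartAt (RSpace n) x).left_inv (mem_chart_source _ x)] at this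
  filter_upwards [ht.eventually hA, (chartAt (RSpace n) x).open_target.mem_nhds
    ((chartAt (RSpace n) x).map_source (mem_chart_source _ x))] with y hy hy'
  simp only [writtenInExtChartAt, mfld_simps]
  rw [hy, (chartAt (RSpace n) x).right_inv hy']

/-- A development map: a local affine diffeomorphism `M → ℝⁿ`. -/
def IsDevelopingMap (dev : M → RSpace n) : Prop :=
  ∀ x, ∃ A : RSpace n ≃ᵃ[ℝ] RSpace n, ∀ᶠ y in 𝓝 x, dev y = A (chartAt (RSpace n) x y)

/-- A vector field is affine if its (local) flow preserves the flat connection: whenever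
`Φ t x`, `x ∈ U`, `|t| < ε`, is a local flow of `ξ`, every `Φ t` is an affine map on `U`. -/
def IsAffineField (ξ : (x : M) → TangentSpace 𝓘(ℝ, RSpace n) x) : Prop :=
  ∀ (U : Set M) (ε : ℝ) (Φ : ℝ → M → M), IsOpen U → 0 < ε →
    (∀ x ∈ U, Φ 0 x = x ∧ IsMIntegralCurveOn (fun t => Φ t x) ξ (Set.Ioo (-ε) ε)) →
    ∀ t ∈ Set.Ioo (-ε) ε, ∀ x ∈ U, IsAffineMapAt n (Φ t) x

/-- A vector field is complete if every point lies on an integral curve defined for all times. -/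
def IsCompleteField (ξ : (x : M) → TangentSpace 𝓘(ℝ, RSpace n) x) : Prop :=
  ∀ x : M, ∃ γ : ℝ → M, γ 0 = x ∧ IsMIntegralCurve γ ξ

end Affine

/-! ### Vector fields, Lie derivatives and exterior derivatives on manifolds -/

section General

variable {F : Type*} [NormedAddCommGroup F] [NormedSpace ℝ F] {H : Type*} [TopologicalSpace H]
  (J : ModelWithCorners ℝ F H) {N : Type*} [TopologicalSpace N] [ChartedSpace H N]
  [IsManifold J 1 N]

/-- The vector field `X` is smooth at `x`. -/
def SmoothFieldAt (X : (x : N) → TangentSpace J x) (x : N) : Prop :=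
  ContMDiffAt J J.tangent ∞ (fun y => (⟨y, X y⟩ : TangentBundle J N)) x

/-- The directional derivative at `x` of the function `f` along the tangent vector `v`. -/
def dirDeriv (f : N → ℝ) (x : N) (v : TangentSpace J x) : ℝ :=
  mfderiv J 𝓘(ℝ, ℝ) f x v

/-- The value at `x` of `(L_ξ b)(Y, Z) = ξ (b(Y, Z)) - b([ξ, Y], Z) - b(Y, [ξ, Z])`, the Lie
derivative of the bilinear form `b`. -/
def lieDerivForm (ξ : (x : N) → TangentSpace J x)
    (b : (x : N) → TangentSpace J x → TangentSpace J x → ℝ)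
    (Y Z : (x : N) → TangentSpace J x) (x : N) : ℝ :=
  dirDeriv J (fun y => b y (Y y) (Z y)) x (ξ x)
    - b x (VectorField.mlieBracket J ξ Y x) (Z x) - b x (Y x) (VectorField.mlieBracket J ξ Z x)

/-- The value at `x` of `dΩ(X, Y, Z)` for a two-form `Ω`. -/
def extDerivTwoForm (Ω : (x : N) → TangentSpace J x → TangentSpace J x → ℝ)
    (X Y Z : (x : N) → TangentSpace J x) (x : N) : ℝ :=
  dirDeriv J (fun y => Ω y (Y y) (Z y)) x (X x)
    + dirDeriv J (fun y => Ω y (Z y) (X y)) x (Y x)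
    + dirDeriv J (fun y => Ω y (X y) (Y y)) x (Z x)
    - Ω x (VectorField.mlieBracket J X Y x) (Z x)
    - Ω x (VectorField.mlieBracket J Y Z x) (X x)
    - Ω x (VectorField.mlieBracket J Z X x) (Y x)

/-! ### Complex, Kähler and conformally Kähler structures -/

/-- The differential of a `ℂᵏ`-valued function. -/
def complexDiff {k : ℕ} (z : N → (Fin k → ℂ)) (y : N) : TangentSpace J y →L[ℝ] (Fin k → ℂ) :=
  mfderiv J 𝓘(ℝ, Fin k → ℂ) z y

/-- `I` is an (integrable) complex structure of complex dimension `k`: `I² = -1`, and around every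
point there are smooth complex coordinates `z : N ⊇ U → ℂᵏ` with `dz ∘ I = √-1 dz`.
(In particular `I` is smooth.) -/
structure IsComplexStructure (k : ℕ) (I : (x : N) → TangentSpace J x →L[ℝ] TangentSpace J x) :
    Prop where
  sq : ∀ x v, I x (I x v) = -v
  coordinates : ∀ x : N, ∃ z : OpenPartialHomeomorph N (Fin k → ℂ), x ∈ z.source ∧
    ContMDiffOn J 𝓘(ℝ, Fin k → ℂ) ∞ z z.source ∧
    ContMDiffOn 𝓘(ℝ, Fin k → ℂ) J ∞ z.symm z.target ∧
    ∀ y ∈ z.source, ∀ v : TangentSpace J y,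
      complexDiff J z y (I y v) = Complex.I • complexDiff J z y v

/-- `(I, Ω)` is a Kähler structure of complex dimension `k`: `I` is a complex structure and `Ω`
is a closed form, `Ω = h(I ·, ·)` for an `I`-invariant smooth Riemannian metric `h`. -/
structure IsKahlerStructure (k : ℕ) (I : (x : N) → TangentSpace J x →L[ℝ] TangentSpace J x)
    (Ω : (x : N) → TangentSpace J x → TangentSpace J x → ℝ) : Prop where
  complex : IsComplexStructure J k I
  metric : ∃ h : ContMDiffRiemannianMetric J ∞ F (fun x : N => TangentSpace J x),
    (∀ x v w, h.inner x (I x v) (I x w) = h.inner x v w) ∧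
    ∀ x v w, Ω x v w = h.inner x (I x v) w
  closed : ∀ (X Y Z : (x : N) → TangentSpace J x) (x : N),
    SmoothFieldAt J X x → SmoothFieldAt J Y x → SmoothFieldAt J Z x →
    extDerivTwoForm J Ω X Y Z x = 0

/-- `(I, η)` is a (globally) conformally Kähler structure: `η = f Ω` with `(I, Ω)` Kähler and `f`
a positive smooth function. -/
def IsConformallyKahlerStructure (k : ℕ)
    (I : (x : N) → TangentSpace J x →L[ℝ] TangentSpace J x)
    (η : (x : N) → TangentSpace J x → TangentSpace J x → ℝ) : Prop :=
  ∃ (f : N → ℝ) (Ω : (x : N) → TangentSpace J x → TangentSpace J x → ℝ),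
    ContMDiff J 𝓘(ℝ, ℝ) ∞ f ∧ (∀ x, 0 < f x) ∧ IsKahlerStructure J k I Ω ∧
    ∀ x v w, η x v w = f x * Ω x v w

/-- The pair `(I, Ω)` is invariant under the group `Γ` acting on `N` through `ψ`: `Γ` acts by
smooth maps which preserve `I` and `Ω`. -/
def IsInvariantStructure {Γ : Type*} [Group Γ] (ψ : Γ →* Equiv.Perm N)
    (I : (x : N) → TangentSpace J x →L[ℝ] TangentSpace J x)
    (Ω : (x : N) → TangentSpace J x → TangentSpace J x → ℝ) : Prop :=
  ∀ a : Γ, ContMDiff J J ∞ (ψ a) ∧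
    (∀ x v, mfderiv J J (ψ a) x (I x v) = I (ψ a x) (mfderiv J J (ψ a) x v)) ∧
    ∀ x v w, Ω (ψ a x) (mfderiv J J (ψ a) x v) (mfderiv J J (ψ a) x w) = Ω x v w

/-- `(N, I, η)` is a homogeneous conformally Kähler manifold for the group `Γ` acting through `ψ`:
a conformally Kähler manifold with a transitive action preserving the structure. -/
structure IsHomogeneousConformallyKahler (k : ℕ) {Γ : Type*} [Group Γ] (ψ : Γ →* Equiv.Perm N)
    (I : (x : N) → TangentSpace J x →L[ℝ] TangentSpace J x)
    (η : (x : N) → TangentSpace J x → TangentSpace J x → ℝ) : Prop where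
  conformallyKahler : IsConformallyKahlerStructure J k I η
  invariant : IsInvariantStructure J ψ I η
  transitive : ∀ x y : N, ∃ a : Γ, ψ a x = y

end General

/-! ### Selfsimilar Hessian manifolds -/

section Hessian

variable {n : ℕ} {M : Type*} [TopologicalSpace M] [ChartedSpace (RSpace n) M]
  [FlatAffineManifold n M]

/-- Smooth Riemannian metrics on `M`. -/
abbrev Metric (n : ℕ) (M : Type*) [TopologicalSpace M] [ChartedSpace (RSpace n) M]
    [FlatAffineManifold n M] :=
  ContMDiffRiemannianMetric 𝓘(ℝ, RSpace n) ∞ (RSpace n)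
    (fun x : M => TangentSpace 𝓘(ℝ, RSpace n) x)

/-- The differential `T_y M → ℝⁿ` of the chart (flat coordinates) at `x`. -/
def dchart (x y : M) : TangentSpace 𝓘(ℝ, RSpace n) y →L[ℝ] RSpace n :=
  mfderiv 𝓘(ℝ, RSpace n) 𝓘(ℝ, RSpace n) (chartAt (RSpace n) x) y

/-- `g` is a Hessian metric: near every point, in flat coordinates,
`g = ∑ ∂²φ/∂xⁱ∂xʲ dxⁱ dxʲ` for a smooth function `φ`. -/
def IsHessianMetric (g : Metric n M) : Prop :=
  ∀ x : M, ∃ (V : Set (RSpace n)) (φ : RSpace n → ℝ), IsOpen V ∧ chartAt (RSpace n) x x ∈ V ∧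
    ContDiffOn ℝ ∞ φ V ∧
    ∀ y ∈ (chartAt (RSpace n) x).source, chartAt (RSpace n) x y ∈ V →
      ∀ v w : TangentSpace 𝓘(ℝ, RSpace n) y,
        g.inner y v w
          = fderiv ℝ (fderiv ℝ φ) (chartAt (RSpace n) x y) (dchart x y v) (dchart x y w)

/-- `(M, ∇, g, ξ)` is a selfsimilar Hessian manifold: `g` is Hessian, `ξ` is a smooth affine
vector field, and `L_ξ g = 2 g`. -/
structure IsSelfsimilarHessian (g : Metric n M)
    (ξ : (x : M) → TangentSpace 𝓘(ℝ, RSpace n) x) : Prop where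
  hessian : IsHessianMetric g
  smooth : ∀ x, SmoothFieldAt 𝓘(ℝ, RSpace n) ξ x
  affine : IsAffineField ξ
  lieDeriv : ∀ (Y Z : (x : M) → TangentSpace 𝓘(ℝ, RSpace n) x) (x : M),
    SmoothFieldAt 𝓘(ℝ, RSpace n) Y x → SmoothFieldAt 𝓘(ℝ, RSpace n) Z x →
    lieDerivForm 𝓘(ℝ, RSpace n) ξ (fun y v w => g.inner y v w) Y Z x = 2 * g.inner x (Y x) (Z x)

/-- `φ` is an affine automorphism of `M` which preserves `g` and `ξ`. -/
structure IsAffineIsometry (g : Metric n M) (ξ : (x : M) → TangentSpace 𝓘(ℝ, RSpace n) x)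
    (φ : Equiv.Perm M) : Prop where
  affine : ∀ x, IsAffineMapAt n φ x
  affine_symm : ∀ x, IsAffineMapAt n φ.symm x
  isometry : ∀ (x : M) (v w : TangentSpace 𝓘(ℝ, RSpace n) x),
    g.inner (φ x) (mfderiv 𝓘(ℝ, RSpace n) 𝓘(ℝ, RSpace n) φ x v)
      (mfderiv 𝓘(ℝ, RSpace n) 𝓘(ℝ, RSpace n) φ x w) = g.inner x v w
  field : ∀ x : M, mfderiv 𝓘(ℝ, RSpace n) 𝓘(ℝ, RSpace n) φ x (ξ x) = ξ (φ x)

/-- The group `G` of affine isometries of `(M, ∇, g)` preserving `ξ`. -/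
def affineIsometryGroup (g : Metric n M) (ξ : (x : M) → TangentSpace 𝓘(ℝ, RSpace n) x) :
    Subgroup (Equiv.Perm M) where
  carrier := {φ | IsAffineIsometry g ξ φ}
  one_mem' := by
    have h1 : ∀ x : M, IsAffineMapAt n (id : M → M) x := fun x =>
      ⟨continuousAt_id, AffineMap.id ℝ _, Filter.Eventually.of_forall fun y => rfl⟩
    refine ⟨h1, h1, fun x v w => ?_, fun x => ?_⟩
    · have : mfderiv 𝓘(ℝ, RSpace n) 𝓘(ℝ, RSpace n) (⇑(1 : Equiv.Perm M)) x
        = ContinuousLinearMap.id ℝ _ := mfderiv_id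
      rw [this]; rfl
    · have : mfderiv 𝓘(ℝ, RSpace n) 𝓘(ℝ, RSpace n) (⇑(1 : Equiv.Perm M)) x
        = ContinuousLinearMap.id ℝ _ := mfderiv_id
      rw [this]; rfl
  mul_mem' := by
    intro a b ha hb
    have hd : ∀ x : M, mfderiv 𝓘(ℝ, RSpace n) 𝓘(ℝ, RSpace n) (⇑(a * b)) x
        = (mfderiv 𝓘(ℝ, RSpace n) 𝓘(ℝ, RSpace n) a (b x)).comp
          (mfderiv 𝓘(ℝ, RSpace n) 𝓘(ℝ, RSpace n) b x) := fun x =>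
      mfderiv_comp x (ha.affine (b x)).mdifferentiableAt (hb.affine x).mdifferentiableAt
    refine ⟨fun x => (ha.affine (b x)).comp (hb.affine x),
      fun x => (hb.affine_symm (a.symm x)).comp (ha.affine_symm x), fun x v w => ?_, fun x => ?_⟩
    · rw [hd]
      exact (ha.isometry (b x) _ _).trans (hb.isometry x v w)
    · rw [hd]
      exact (congrArg _ (hb.field x)).trans (ha.field (b x))
  inv_mem' := by
    intro a ha
    have hd : ∀ x : M, ∀ v : TangentSpace 𝓘(ℝ, RSpace n) x,
        mfderiv 𝓘(ℝ, RSpace n) 𝓘(ℝ, RSpace n) a (a.symm x)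
          (mfderiv 𝓘(ℝ, RSpace n) 𝓘(ℝ, RSpace n) a.symm x v) = v := by
      intro x v
      have h1 := mfderiv_comp (I := 𝓘(ℝ, RSpace n)) (I' := 𝓘(ℝ, RSpace n))
        (I'' := 𝓘(ℝ, RSpace n)) x (ha.affine (a.symm x)).mdifferentiableAt
        (ha.affine_symm x).mdifferentiableAt
      have h2 : (a ∘ a.symm : M → M) = id := by ext y; simp
      rw [h2, mfderiv_id] at h1
      exact (congrArg (fun L => L v) h1).symm
    have hd' : ∀ x : M, ∀ v : TangentSpace 𝓘(ℝ, RSpace n) x,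
        mfderiv 𝓘(ℝ, RSpace n) 𝓘(ℝ, RSpace n) a.symm (a x)
          (mfderiv 𝓘(ℝ, RSpace n) 𝓘(ℝ, RSpace n) a x v) = v := by
      intro x v
      have h1 := mfderiv_comp (I := 𝓘(ℝ, RSpace n)) (I' := 𝓘(ℝ, RSpace n))
        (I'' := 𝓘(ℝ, RSpace n)) x (ha.affine_symm (a x)).mdifferentiableAt
        (ha.affine x).mdifferentiableAt
      have h2 : (a.symm ∘ a : M → M) = id := by ext y; simp
      rw [h2, mfderiv_id] at h1
      exact (congrArg (fun L => L v) h1).symm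
    refine ⟨ha.affine_symm, ha.affine, fun x v w => ?_, fun x => ?_⟩
    · obtain ⟨y, rfl⟩ := a.surjective x
      have h := ha.isometry (a.symm (a y))
        (mfderiv 𝓘(ℝ, RSpace n) 𝓘(ℝ, RSpace n) a.symm (a y) v)
        (mfderiv 𝓘(ℝ, RSpace n) 𝓘(ℝ, RSpace n) a.symm (a y) w)
      rw [hd, hd] at h
      have e : a (a.symm (a y)) = a y := a.apply_symm_apply _
      rw [e] at h
      exact h.symm
    · obtain ⟨y, rfl⟩ := a.surjective x
      have h := hd' y (ξ y)
      rw [ha.field y] at h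
      have e : a.symm (a y) = y := a.symm_apply_apply _
      change mfderiv 𝓘(ℝ, RSpace n) 𝓘(ℝ, RSpace n) a.symm (a y) (ξ (a y)) = ξ (a.symm (a y))
      rw [h, e]

/-! ### The r-map on the tangent bundle, in flat coordinates -/

/-- The differential at `p` of the coordinates `(x, y) = (x¹, …, xⁿ, y¹, …, yⁿ)` on `TM` which
correspond to the flat coordinates `x` of `M` at the base point of `p`. -/
def dxy (p : TangentBundle 𝓘(ℝ, RSpace n) M) :
    TangentSpace 𝓘(ℝ, RSpace n).tangent p →L[ℝ] RSpace n × RSpace n :=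
  mfderiv 𝓘(ℝ, RSpace n).tangent 𝓘(ℝ, RSpace n × RSpace n)
    (extChartAt 𝓘(ℝ, RSpace n).tangent p) p

/-- The complex structure on `TM`: `I(∂/∂xⁱ) = ∂/∂yⁱ`, `I(∂/∂yⁱ) = -∂/∂xⁱ`. -/
def complexTM (p : TangentBundle 𝓘(ℝ, RSpace n) M) :
    TangentSpace 𝓘(ℝ, RSpace n).tangent p →L[ℝ] TangentSpace 𝓘(ℝ, RSpace n).tangent p :=
  (dxy p).inverse ∘L
    ((-ContinuousLinearMap.snd ℝ (RSpace n) (RSpace n)).prod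
      (ContinuousLinearMap.fst ℝ (RSpace n) (RSpace n))) ∘L dxy p

/-- The metric `gʳ = π^* g_{ij} (dxⁱ dxʲ + dyⁱ dyʲ)` on `TM`. -/
def metricTM (g : Metric n M) (p : TangentBundle 𝓘(ℝ, RSpace n) M)
    (X Y : TangentSpace 𝓘(ℝ, RSpace n).tangent p) : ℝ :=
  g.inner p.proj ((dchart p.proj p.proj).inverse (dxy p X).1)
      ((dchart p.proj p.proj).inverse (dxy p Y).1)
    + g.inner p.proj ((dchart p.proj p.proj).inverse (dxy p X).2)
      ((dchart p.proj p.proj).inverse (dxy p Y).2)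

/-! ### The r-map on `M × ℝⁿ` -/

/-- The manifold structure model of `M × ℝⁿ`. -/
abbrev prodModel (n : ℕ) := (𝓘(ℝ, RSpace n)).prod 𝓘(ℝ, RSpace n)

/-- The differential of a development map. -/
def ddev (dev : M → RSpace n) (x : M) : TangentSpace 𝓘(ℝ, RSpace n) x →L[ℝ] RSpace n :=
  mfderiv 𝓘(ℝ, RSpace n) 𝓘(ℝ, RSpace n) dev x

/-- The complex structure on `M × ℝⁿ`: if `T_x M` is identified with `ℝⁿ` through the
development map, then `I (X × Y) = (-Y) × X`. -/
def complexI (dev : M → RSpace n) (q : M × RSpace n) :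
    TangentSpace (prodModel n) q →L[ℝ] TangentSpace (prodModel n) q :=
  show (TangentSpace 𝓘(ℝ, RSpace n) q.1 × RSpace n) →L[ℝ]
      (TangentSpace 𝓘(ℝ, RSpace n) q.1 × RSpace n) from
    (-((ddev dev q.1).inverse ∘L
      ContinuousLinearMap.snd ℝ (TangentSpace 𝓘(ℝ, RSpace n) q.1) (RSpace n))).prod
    (ddev dev q.1 ∘L
      ContinuousLinearMap.fst ℝ (TangentSpace 𝓘(ℝ, RSpace n) q.1) (RSpace n))

/-- The pullback `π^* g` along the projection `π : M × ℝⁿ → M`. -/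
def pullbackMetric (g : Metric n M) (q : M × RSpace n)
    (X Y : TangentSpace (prodModel n) q) : ℝ :=
  g.inner q.1 (mfderiv (prodModel n) 𝓘(ℝ, RSpace n) Prod.fst q X)
    (mfderiv (prodModel n) 𝓘(ℝ, RSpace n) Prod.fst q Y)

/-- The metric `gʳ(X, Y) = (π^* g)(X, Y) + (π^* g)(I X, I Y)` on `M × ℝⁿ`. -/
def metricR (g : Metric n M) (dev : M → RSpace n) (q : M × RSpace n)
    (X Y : TangentSpace (prodModel n) q) : ℝ :=
  pullbackMetric g q X Y + pullbackMetric g q (complexI dev q X) (complexI dev q Y)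

/-- The Kähler form `ω(X, Y) = gʳ(I X, Y)`. -/
def omegaR (g : Metric n M) (dev : M → RSpace n) (q : M × RSpace n)
    (X Y : TangentSpace (prodModel n) q) : ℝ :=
  metricR g dev q (complexI dev q X) Y

/-- The form `ω_{c.K.} = π^*(g(ξ, ξ)⁻¹) ω`. -/
def omegaCK (g : Metric n M) (ξ : (x : M) → TangentSpace 𝓘(ℝ, RSpace n) x)
    (dev : M → RSpace n) (q : M × RSpace n) (X Y : TangentSpace (prodModel n) q) : ℝ :=
  (g.inner q.1 (ξ q.1) (ξ q.1))⁻¹ * omegaR g dev q X Y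

end Hessian

/-! ### The semidirect product and its action on `M × ℝⁿ` -/

section SemidirectAction

variable {n : ℕ} {K : Type*} [Group K]

/-- The action of `K` on the group `ℝⁿ` by the linear parts of an affine action `θ`. -/
def linearAction (θ : K →* (RSpace n ≃ᵃ[ℝ] RSpace n)) : K →* MulAut (Multiplicative (RSpace n)) where
  toFun a := AddEquiv.toMultiplicative (θ a).linear.toAddEquiv
  map_one' := by ext v; simp; rfl
  map_mul' a b := by ext v; simp; rfl

/-- The group `K ⋉_θ ℝⁿ`. -/
abbrev AffineSemidirect (θ : K →* (RSpace n ≃ᵃ[ℝ] RSpace n)) :=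
  Multiplicative (RSpace n) ⋊[linearAction θ] K

/-- The action `ψ` of `K ⋉_θ ℝⁿ` on `M × ℝⁿ`: `ψ_{a ⋉ u}(m × v) = φ_a(m) × (θ_a(v) + u)`. -/
def psi {M : Type*} (φ : K →* Equiv.Perm M) (θ : K →* (RSpace n ≃ᵃ[ℝ] RSpace n)) :
    AffineSemidirect θ →* Equiv.Perm (M × RSpace n) where
  toFun s := (φ s.right).prodCongr
    ((θ s.right).toEquiv.trans (Equiv.addRight (Multiplicative.toAdd s.left)))
  map_one' := by ext1 q; simp
  map_mul' s t := by
    ext1 q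
    refine Prod.ext (by simp) ?_
    have h := (θ s.right).map_vadd (θ t.right q.2) (Multiplicative.toAdd t.left)
    simp only [vadd_eq_add] at h
    have h2 : Multiplicative.toAdd (linearAction θ s.right t.left)
      = (θ s.right).linear (Multiplicative.toAdd t.left) := rfl
    simp [h2]
    rw [add_comm (θ t.right q.2), h]
    abel

end SemidirectAction

end SelfsimilarHessian

end

open SelfsimilarHessian

noncomputable section

namespace SelfsimilarHessian

/-! ### Germs of affine maps -/

/-! Read through a development map, every structure becomes an object with coefficients in `ℝⁿ`, and
the claims become calculus. Germs of affine coordinates form a bundle over `M` with locally constant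
coordinate changes, hence a covering once the affine group is made discrete. Simple connectedness
gives a global section, and evaluating each germ at its base point gives `dev`
(`exists_isDevelopingMap`). Since an affine map is determined by its germ, an affine automorphism of
the connected manifold `M` corresponds through `dev` to exactly one affine transformation of `ℝⁿ`;
uniqueness makes this correspondence a homomorphism (`exists_affineAction`).

Under `dprod`, the differential of `dev × id`, the operator `I` is the constant rotation `(a, b) ↦
(-b, a)`, so `dev x + iv` gives local holomorphic coordinates. The coefficients of `ω` are those of
`g` and depend on the base point only. Its closedness follows from the total symmetry of `∂ₖ gᵢⱼ`,
which are third derivatives of a potential (`devCubic_swap_left`, `extDerivTwoForm_omegaR`).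

An affine map which preserves `ξ` and multiplies `g` by a constant `c` multiplies both `ω` and `g(ξ,
ξ)` by `c`, so their quotient is unchanged; fibre translations are invisible to differentials
(`isInvariantStructure`). For `G` the constant is `1`. For the flow it is `e^{2t}`: the equation
`L_ξ g = 2g` becomes the scalar equation `E' = 2E` along flow lines (`devCubic_field`,
`inner_flow`). The same scaling shows that each flow line meets `g(ξ, ξ) = 1`, so transitivity of
`G` there, together with the flow and the translations, gives transitivity on `M × ℝⁿ`. -/

/-- Two affine maps which agree near a point are equal. -/
lemma affineMap_eq_of_eventuallyEq {E F : Type*} [NormedAddCommGroup E] [NormedSpace ℝ E]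
    [AddCommGroup F] [Module ℝ F] {A B : E →ᵃ[ℝ] F} {x : E}
    (h : ∀ᶠ y in 𝓝 x, A y = B y) : A = B := by
  -- Some `x + t • v` with `t ≠ 0` lies in the neighbourhood of agreement; subtracting the values at
  -- `x` and dividing by `t` compares the linear parts at `v`.
  have key : ∀ v, A.linear v = B.linear v := by
    intro v
    have ht : Filter.Tendsto (fun t : ℝ => x + t • v) (𝓝[≠] 0) (𝓝 x) := by
      have : ContinuousAt (fun t : ℝ => x + t • v) 0 := by fun_prop
      simpa [ContinuousAt] using this.mono_left nhdsWithin_le_nhds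
    obtain ⟨t, h1, h2⟩ := ((ht.eventually h).and self_mem_nhdsWithin).exists
    have h0 := h.self_of_nhds
    have hA := A.map_vadd x (t • v)
    have hB := B.map_vadd x (t • v)
    simp only [vadd_eq_add, map_smul] at hA hB
    rw [add_comm (t • v)] at hA hB
    rw [h1, h0, hB] at hA
    have := add_right_cancel hA
    exact (smul_right_injective F (h2 : t ≠ 0) this).symm
  ext y
  have hA := A.map_vadd x (y - x)
  have hB := B.map_vadd x (y - x)
  simp only [vadd_eq_add, sub_add_cancel] at hA hB
  rw [hA, hB, key, h.self_of_nhds]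

section Development

variable {n : ℕ} {M : Type*} [TopologicalSpace M]

/-- Affine maps which agree near a point after composition with a chart are equal. -/
lemma affineMap_eq_of_eventuallyEq_comp {A B : RSpace n →ᵃ[ℝ] RSpace n}
    (e : OpenPartialHomeomorph M (RSpace n)) {y : M} (hy : y ∈ e.source)
    (h : ∀ᶠ z in 𝓝 y, A (e z) = B (e z)) : A = B := by
  refine affineMap_eq_of_eventuallyEq (x := e y) ?_
  have ht : Filter.Tendsto e.symm (𝓝 (e y)) (𝓝 y) := by
    have := e.symm.continuousAt (e.map_source hy)
    rwa [ContinuousAt, e.left_inv hy] at this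
  filter_upwards [ht.eventually h, e.open_target.mem_nhds (e.map_source hy)] with z h1 h2
  rwa [e.right_inv h2] at h1

lemma affineEquiv_eq_of_eventuallyEq_comp {A B : RSpace n ≃ᵃ[ℝ] RSpace n}
    (e : OpenPartialHomeomorph M (RSpace n)) {y : M} (hy : y ∈ e.source)
    (h : ∀ᶠ z in 𝓝 y, A (e z) = B (e z)) : A = B :=
  AffineEquiv.toAffineMap_injective (affineMap_eq_of_eventuallyEq_comp e hy h)

variable [ChartedSpace (RSpace n) M] [FlatAffineManifold n M]

/-- Near a point of both chart domains, two charts differ by an affine transformation. -/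
lemma exists_affine_transition (x x' y : M) (hx : y ∈ (chartAt (RSpace n) x).source)
    (hx' : y ∈ (chartAt (RSpace n) x').source) :
    ∃ A : RSpace n ≃ᵃ[ℝ] RSpace n,
      ∀ᶠ z in 𝓝 y, chartAt (RSpace n) x' z = A (chartAt (RSpace n) x z) := by
  set e := chartAt (RSpace n) x
  set e' := chartAt (RSpace n) x'
  obtain ⟨A, hA⟩ := FlatAffineManifold.affine_transition (n := n) e (chart_mem_atlas _ x) e'
    (chart_mem_atlas _ x') (e y) (by simp [hx, hx'])
  refine ⟨A, ?_⟩
  filter_upwards [(e.continuousAt hx).eventually hA, e.open_source.mem_nhds hx] with z hz hz'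
  simpa [e.left_inv hz'] using hz

open Classical in
/-- The affine transformation by which the charts at `x` and `x'` differ near `y`. -/
def affineTransition (x x' y : M) : RSpace n ≃ᵃ[ℝ] RSpace n :=
  if h : y ∈ (chartAt (RSpace n) x).source ∧ y ∈ (chartAt (RSpace n) x').source then
    (exists_affine_transition x x' y h.1 h.2).choose else AffineEquiv.refl ℝ _

lemma affineTransition_spec {x x' y : M} (hx : y ∈ (chartAt (RSpace n) x).source)
    (hx' : y ∈ (chartAt (RSpace n) x').source) :
    ∀ᶠ z in 𝓝 y, chartAt (RSpace n) x' z = affineTransition x x' y (chartAt (RSpace n) x z) := by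
  rw [affineTransition, dif_pos ⟨hx, hx'⟩]
  exact (exists_affine_transition x x' y hx hx').choose_spec

/-- Although the transition is chosen, its germ determines it, so identities between transitions can
be checked on germs. -/
lemma affineTransition_eq {x x' y : M} (hx : y ∈ (chartAt (RSpace n) x).source)
    (hx' : y ∈ (chartAt (RSpace n) x').source) {A : RSpace n ≃ᵃ[ℝ] RSpace n}
    (h : ∀ᶠ z in 𝓝 y, chartAt (RSpace n) x' z = A (chartAt (RSpace n) x z)) :
    affineTransition x x' y = A := by
  refine affineEquiv_eq_of_eventuallyEq_comp (chartAt (RSpace n) x) hx ?_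
  filter_upwards [affineTransition_spec hx hx', h] with z h1 h2
  rw [← h1, h2]

/-- An equality of germs at `y` persists at nearby points. This local constancy makes the coordinate
changes below continuous for a discrete fibre. -/
lemma eventually_affineTransition_eq {x x' y : M} (hx : y ∈ (chartAt (RSpace n) x).source)
    (hx' : y ∈ (chartAt (RSpace n) x').source) :
    ∀ᶠ z in 𝓝 y, affineTransition (n := n) x x' z = affineTransition x x' y := by
  filter_upwards [eventually_eventually_nhds.2 (affineTransition_spec hx hx'),
    (chartAt (RSpace n) x).open_source.mem_nhds hx,
    (chartAt (RSpace n) x').open_source.mem_nhds hx'] with z h1 h2 h3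
  exact affineTransition_eq h2 h3 h1

variable (n M) in
/-- The bundle whose fibre at `x` consists of the germs at `x` of affine local coordinates. -/
def developmentCore [TopologicalSpace (RSpace n ≃ᵃ[ℝ] RSpace n)]
    [DiscreteTopology (RSpace n ≃ᵃ[ℝ] RSpace n)] :
    FiberBundleCore M M (RSpace n ≃ᵃ[ℝ] RSpace n) where
  baseSet x := (chartAt (RSpace n) x).source
  isOpen_baseSet x := (chartAt (RSpace n) x).open_source
  indexAt := id
  mem_baseSet_at x := mem_chart_source _ x
  -- `A` stands for the germ `A ∘ chart_x`. Substituting `chart_x = T ∘ chart_x'` turns it into `(A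
  -- ∘ T) ∘ chart_x'`, hence the reversed order of the indices.
  coordChange x x' y A := (affineTransition x' x y).trans A
  coordChange_self x y hy A := by
    rw [affineTransition_eq (A := AffineEquiv.refl ℝ _) hy hy (Filter.Eventually.of_forall
      fun z => rfl)]
    rfl
  continuousOn_coordChange x x' := by
    rintro ⟨y, A⟩ ⟨⟨hx, hx'⟩, -⟩
    refine ContinuousAt.continuousWithinAt ?_
    have h : ∀ᶠ p : M × (RSpace n ≃ᵃ[ℝ] RSpace n) in 𝓝 (y, A),
        (affineTransition x' x p.1).trans p.2 = (affineTransition x' x y).trans A := by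
      have h1 := eventually_affineTransition_eq (n := n) hx' hx
      have h2 : ∀ᶠ B in 𝓝 A, B = A := by simp [nhds_discrete]
      rw [nhds_prod_eq]
      filter_upwards [h1.prod_mk h2] with p hp
      rw [hp.1, hp.2]
    exact continuousAt_const.congr (h.mono fun p hp => hp.symm)
  coordChange_comp x₁ x₂ x₃ y := by
    rintro ⟨⟨h1, h2⟩, h3⟩ A
    have : affineTransition (n := n) x₃ x₁ y
        = (affineTransition x₃ x₂ y).trans (affineTransition x₂ x₁ y) := by
      refine affineTransition_eq h3 h1 ?_
      filter_upwards [affineTransition_spec (n := n) h3 h2, affineTransition_spec (n := n) h2 h1]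
        with z hz hz'
      simp [hz', hz]
    rw [this]
    rfl

variable (n M) in
/-- A simply connected flat affine manifold has a development map. -/
theorem exists_isDevelopingMap [SimplyConnectedSpace M] :
    ∃ dev : M → RSpace n, IsDevelopingMap dev := by
  -- With a discrete fibre the bundle of germs is a covering space.
  let _ : TopologicalSpace (RSpace n ≃ᵃ[ℝ] RSpace n) := ⊥
  have _ : DiscreteTopology (RSpace n ≃ᵃ[ℝ] RSpace n) := ⟨rfl⟩
  have _ : LocallyPathConnectedSpace M := ChartedSpace.locallyPathConnectedSpace (RSpace n) M
  let Z := developmentCore n M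
  have hc : IsCoveringMap (π (RSpace n ≃ᵃ[ℝ] RSpace n) Z.Fiber) := FiberBundle.isCoveringMap
  have x₀ : M := Classical.arbitrary M
  -- Lifting the identity of the simply connected `M` gives a global section, normalized to be the
  -- germ of the chart at `x₀`.
  obtain ⟨s, ⟨-, hs⟩, -⟩ := hc.existsUnique_continuousMap_lifts (ContinuousMap.id M) x₀
    (⟨x₀, AffineEquiv.refl ℝ _⟩ : TotalSpace (RSpace n ≃ᵃ[ℝ] RSpace n) Z.Fiber) rfl
  have hs' : ∀ x, (s x).proj = x := fun x => congrFun hs x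
  let A : M → (RSpace n ≃ᵃ[ℝ] RSpace n) := fun x => (s x).2
  -- The value of `dev` at `x` is that of the germ `s x`. Near `x` all these germs come from the
  -- single map `A x ∘ chart_x`, because a continuous section is locally constant in a
  -- trivialization.
  refine ⟨fun x => A x (chartAt (RSpace n) x x), fun x => ⟨A x, ?_⟩⟩
  have h1 : ContinuousAt (fun y => (Z.localTrivAt x (s y)).2) x := by
    have := (FiberBundle.continuousAt_totalSpace (F := RSpace n ≃ᵃ[ℝ] RSpace n) s (x₀ := x)).1
      s.continuous.continuousAt
    have h2 := this.2
    rw [hs' x] at h2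
    exact h2
  have h3 : ∀ᶠ y in 𝓝 x, (Z.localTrivAt x (s y)).2 = (Z.localTrivAt x (s x)).2 :=
    h1.eventually (p := fun B : RSpace n ≃ᵃ[ℝ] RSpace n => B = (Z.localTrivAt x (s x)).2)
      (by rw [nhds_discrete]; exact Filter.eventually_pure.2 rfl)
  have h4 : ∀ y, (Z.localTrivAt x (s y)).2 = (affineTransition x y y).trans (A y) := by
    intro y
    rw [Z.localTrivAt_snd]
    change (affineTransition x (s y).proj (s y).proj).trans (s y).2 = _
    rw [hs' y]
  filter_upwards [h3, (chartAt (RSpace n) x).open_source.mem_nhds (mem_chart_source _ x)]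
    with y hy hy'
  rw [h4, h4] at hy
  have e1 : affineTransition x x x = AffineEquiv.refl ℝ (RSpace n) :=
    affineTransition_eq (mem_chart_source _ x) (mem_chart_source _ x)
      (Filter.Eventually.of_forall fun z => rfl)
  rw [e1] at hy
  have e2 := (affineTransition_spec hy' (mem_chart_source (RSpace n) y)).self_of_nhds
  rw [e2]
  exact congrArg (fun B : RSpace n ≃ᵃ[ℝ] RSpace n => B (chartAt (RSpace n) x y)) hy

end Development

/-! ### Development maps -/

section DevelopingMaps

/-- The derivative of an affine map of `ℝⁿ`. -/
lemma hasFDerivAt_affineMap {n : ℕ} (A : RSpace n →ᵃ[ℝ] RSpace n) (x : RSpace n) :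
    HasFDerivAt (fun y => A y) A.linear.toContinuousLinearMap x := by
  have h : (fun y : RSpace n => A y) = fun y => A.linear.toContinuousLinearMap y + A 0 := by
    ext1 y
    exact congrFun A.decomp y
  rw [h]
  exact A.linear.toContinuousLinearMap.hasFDerivAt.add_const _

variable {n : ℕ} {M : Type*} [TopologicalSpace M] [ChartedSpace (RSpace n) M]

namespace IsDevelopingMap

variable {dev : M → RSpace n}

/-- After shrinking the chart at `x`, composition with the affine homeomorphism `A` makes `dev`
itself a chart. The formula for the inverse serves to prove that inverse holomorphic coordinates are
smooth. -/
lemma exists_chart (hdev : IsDevelopingMap dev) (x : M) :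
    ∃ D : OpenPartialHomeomorph M (RSpace n), x ∈ D.source ∧ Set.EqOn dev D D.source ∧
      D.source ⊆ (chartAt (RSpace n) x).source ∧ ∃ A : RSpace n ≃ᵃ[ℝ] RSpace n,
        (∀ y ∈ D.source, dev y = A (chartAt (RSpace n) x y)) ∧
        ∀ z ∈ D.target, D.symm z = (chartAt (RSpace n) x).symm (A.symm z) := by
  obtain ⟨A, hA⟩ := hdev x
  obtain ⟨U, hU, hUo, hxU⟩ := eventually_nhds_iff.1 hA
  let h : RSpace n ≃ₜ RSpace n :=
    { toEquiv := A.toEquiv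
      continuous_toFun := (contDiff_affineMap A.toAffineMap).continuous
      continuous_invFun := (contDiff_affineMap A.symm.toAffineMap).continuous }
  refine ⟨((chartAt (RSpace n) x).restrOpen U hUo).trans h.toOpenPartialHomeomorph, ?_, ?_, ?_,
    A, ?_, ?_⟩
  · simp [hxU]
  · intro y hy
    have hy' : y ∈ U := by simpa using hy.1.2
    exact hU y hy'
  · intro y hy
    exact hy.1.1
  · intro y hy
    have hy' : y ∈ U := by simpa using hy.1.2
    exact hU y hy'
  · intro z hz
    rfl

lemma continuous (hdev : IsDevelopingMap dev) : Continuous dev := by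
  refine continuous_iff_continuousAt.2 fun x => ?_
  obtain ⟨A, hA⟩ := hdev x
  refine ContinuousAt.congr ?_ (hA.mono fun y hy => hy.symm)
  exact ((contDiff_affineMap A.toAffineMap).continuous.continuousAt).comp
    ((chartAt (RSpace n) x).continuousAt (mem_chart_source _ x))

/-- An affine map is determined by its values on the image of a development map, locally. -/
lemma affineMap_eq (hdev : IsDevelopingMap dev) {A B : RSpace n →ᵃ[ℝ] RSpace n} {x : M}
    (h : ∀ᶠ y in 𝓝 x, A (dev y) = B (dev y)) : A = B := by
  obtain ⟨D, hx, hD, -⟩ := hdev.exists_chart x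
  refine affineMap_eq_of_eventuallyEq_comp D hx ?_
  filter_upwards [h, D.open_source.mem_nhds hx] with y h1 h2
  rwa [← hD h2]

lemma affineEquiv_eq (hdev : IsDevelopingMap dev) [Nonempty M] {A B : RSpace n ≃ᵃ[ℝ] RSpace n}
    (h : ∀ y, A (dev y) = B (dev y)) : A = B :=
  AffineEquiv.toAffineMap_injective (hdev.affineMap_eq (x := Classical.arbitrary M)
    (Filter.Eventually.of_forall h))

/-- On a connected manifold, a map which is locally affine in flat coordinates is an affine
function of a given development map. -/
lemma exists_affineMap (hdev : IsDevelopingMap dev) [PreconnectedSpace M] [Nonempty M]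
    {f : M → RSpace n} (hf : ∀ x, ∃ A : RSpace n →ᵃ[ℝ] RSpace n,
      ∀ᶠ y in 𝓝 x, f y = A (chartAt (RSpace n) x y)) :
    ∃ A : RSpace n →ᵃ[ℝ] RSpace n, ∀ x, f x = A (dev x) := by
  have h1 : ∀ x, ∃ A : RSpace n →ᵃ[ℝ] RSpace n, ∀ᶠ y in 𝓝 x, f y = A (dev y) := by
    intro x
    obtain ⟨A, hA⟩ := hdev x
    obtain ⟨B, hB⟩ := hf x
    refine ⟨B.comp A.symm.toAffineMap, ?_⟩
    filter_upwards [hA, hB] with y h1 h2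
    rw [h2, h1]
    simp
  choose A hA using h1
  -- The same germ of `f` is represented by `A x` and by `A y` for `y` near `x`, and affine maps are
  -- determined by germs; connectedness then leaves a single `A`.
  have h2 : IsLocallyConstant A := by
    rw [IsLocallyConstant.iff_eventually_eq]
    intro x
    filter_upwards [eventually_eventually_nhds.2 (hA x)] with y hy
    refine hdev.affineMap_eq (x := y) ?_
    filter_upwards [hy, hA y] with z h1 h2
    rw [← h1, ← h2]
  obtain ⟨x₀⟩ := ‹Nonempty M›
  refine ⟨A x₀, fun x => ?_⟩
  rw [← h2.apply_eq_of_isPreconnected isPreconnected_univ (Set.mem_univ x) (Set.mem_univ x₀)]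
  exact (hA x).self_of_nhds

/-- An affine automorphism of a connected flat affine manifold is given, through a development
map, by an affine transformation. -/
lemma exists_affineEquiv (hdev : IsDevelopingMap dev) [PreconnectedSpace M] [Nonempty M]
    (φ : Equiv.Perm M) (h1 : ∀ x, IsAffineMapAt n φ x) (h2 : ∀ x, IsAffineMapAt n φ.symm x) :
    ∃ A : RSpace n ≃ᵃ[ℝ] RSpace n, ∀ x, dev (φ x) = A (dev x) := by
  have key : ∀ ψ : M → M, (∀ x, IsAffineMapAt n ψ x) →
      ∃ A : RSpace n →ᵃ[ℝ] RSpace n, ∀ x, dev (ψ x) = A (dev x) := by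
    intro ψ hψ
    refine hdev.exists_affineMap (f := dev ∘ ψ) fun x => ?_
    obtain ⟨hc, A, hA⟩ := hψ x
    obtain ⟨B, hB⟩ := hdev (ψ x)
    refine ⟨B.toAffineMap.comp A, ?_⟩
    filter_upwards [hA, hc.eventually hB] with y h1 h2
    simp [h2, h1]
  obtain ⟨A, hA⟩ := key φ h1
  obtain ⟨B, hB⟩ := key φ.symm h2
  -- The two maps need only be inverse on the image of `dev`, since `dev` is locally open.
  have hAB : A.comp B = AffineMap.id ℝ _ := hdev.affineMap_eq (x := Classical.arbitrary M)
    (Filter.Eventually.of_forall fun y => by simp [← hB, ← hA])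
  have hBA : B.comp A = AffineMap.id ℝ _ := hdev.affineMap_eq (x := Classical.arbitrary M)
    (Filter.Eventually.of_forall fun y => by simp [← hB, ← hA])
  let e : RSpace n ≃ RSpace n :=
    { toFun := A
      invFun := B
      left_inv := fun y => congrArg (fun C : RSpace n →ᵃ[ℝ] RSpace n => C y) hBA
      right_inv := fun y => congrArg (fun C : RSpace n →ᵃ[ℝ] RSpace n => C y) hAB }
  exact ⟨{ toEquiv := e, linear := LinearEquiv.ofBijective A.linear
            (A.linear_bijective_iff.2 e.bijective), map_vadd' := A.map_vadd' }, hA⟩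

/-- The affine action on `ℝⁿ` for which the development map is equivariant, for an action by
affine automorphisms. -/
lemma exists_affineAction (hdev : IsDevelopingMap dev) [PreconnectedSpace M] [Nonempty M]
    {K : Type*} [Group K] (φ : K →* Equiv.Perm M) (h : ∀ k x, IsAffineMapAt n (φ k) x) :
    ∃ θ : K →* (RSpace n ≃ᵃ[ℝ] RSpace n), ∀ k x, dev (φ k x) = θ k (dev x) := by
  have h' : ∀ k x, IsAffineMapAt n (φ k).symm x := by
    intro k x
    have := h k⁻¹ x
    rwa [map_inv] at this
  choose θ hθ using fun k => hdev.exists_affineEquiv (φ k) (h k) (h' k)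
  -- Uniqueness of the affine map attached to each `k` gives multiplicativity.
  refine ⟨MonoidHom.mk' θ fun a b => hdev.affineEquiv_eq fun y => ?_, hθ⟩
  rw [← hθ, map_mul]
  simp [hθ]

lemma contMDiff [FlatAffineManifold n M] (hdev : IsDevelopingMap dev) :
    ContMDiff 𝓘(ℝ, RSpace n) 𝓘(ℝ, RSpace n) ∞ dev := by
  intro x
  obtain ⟨A, hA⟩ := hdev x
  refine ContMDiffAt.congr_of_eventuallyEq ?_ hA
  exact ((contDiff_affineMap A.toAffineMap).contMDiff.contMDiffAt (x := _)).comp x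
    (contMDiffAt_of_mem_maximalAtlas (IsManifold.chart_mem_maximalAtlas x) (mem_chart_source _ x))

lemma hasMFDerivAt [FlatAffineManifold n M] (hdev : IsDevelopingMap dev) (x : M) :
    HasMFDerivAt 𝓘(ℝ, RSpace n) 𝓘(ℝ, RSpace n) dev x (ddev dev x) :=
  ((hdev.contMDiff x).mdifferentiableAt (by simp)).hasMFDerivAt

/-- The differential of a development map in flat coordinates. -/
lemma ddev_eq [FlatAffineManifold n M] {x : M} {A : RSpace n ≃ᵃ[ℝ] RSpace n}
    {y : M} (hy : y ∈ (chartAt (RSpace n) x).source)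
    (h : ∀ᶠ z in 𝓝 y, dev z = A (chartAt (RSpace n) x z)) (v : TangentSpace 𝓘(ℝ, RSpace n) y) :
    ddev dev y v = A.linear (dchart x y v) := by
  have h1 : HasMFDerivAt 𝓘(ℝ, RSpace n) 𝓘(ℝ, RSpace n) (chartAt (RSpace n) x) y (dchart x y) :=
    ((contMDiffAt_of_mem_maximalAtlas (n := ∞) (IsManifold.chart_mem_maximalAtlas x)
      hy).mdifferentiableAt (by simp)).hasMFDerivAt
  have h2 := (hasFDerivAt_affineMap A.toAffineMap (chartAt (RSpace n) x y)).hasMFDerivAt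
  have h3 := (h2.comp y h1).congr_of_eventuallyEq h
  exact congrArg (fun L : TangentSpace 𝓘(ℝ, RSpace n) y →L[ℝ] RSpace n => L v) h3.mfderiv

lemma dchart_isInvertible [FlatAffineManifold n M] {x y : M}
    (hy : y ∈ (chartAt (RSpace n) x).source) :
    (dchart (n := n) x y).IsInvertible := by
  have := isInvertible_mfderiv_extChartAt (I := 𝓘(ℝ, RSpace n)) (x := x) (y := y)
    (by simpa using hy)
  exact this

lemma ddev_isInvertible [FlatAffineManifold n M] (hdev : IsDevelopingMap dev) (x : M) :
    (ddev dev x).IsInvertible := by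
  obtain ⟨A, hA⟩ := hdev x
  have h1 := dchart_isInvertible (n := n) (mem_chart_source (RSpace n) x)
  have h2 : ddev dev x = A.linear.toContinuousLinearEquiv ∘L dchart x x := by
    ext1 v
    exact ddev_eq (mem_chart_source (RSpace n) x) hA v
  rw [h2]
  exact ContinuousLinearMap.isInvertible_equiv.comp h1

lemma inverse_ddev [FlatAffineManifold n M] (hdev : IsDevelopingMap dev) (x : M)
    (v : TangentSpace 𝓘(ℝ, RSpace n) x) : (ddev dev x).inverse (ddev dev x v) = v :=
  (hdev.ddev_isInvertible x).inverse_apply_self v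

lemma ddev_inverse [FlatAffineManifold n M] (hdev : IsDevelopingMap dev) (x : M)
    (v : RSpace n) : ddev dev x ((ddev dev x).inverse v) = v :=
  (hdev.ddev_isInvertible x).self_apply_inverse v

/-- Chain rule on the two sides of `dev ∘ φ = A ∘ dev`. -/
lemma ddev_map [FlatAffineManifold n M] (hdev : IsDevelopingMap dev) {φ : M → M}
    {A : RSpace n ≃ᵃ[ℝ] RSpace n} (h : ∀ x, dev (φ x) = A (dev x)) {x : M}
    (hφ : MDifferentiableAt 𝓘(ℝ, RSpace n) 𝓘(ℝ, RSpace n) φ x)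
    (v : TangentSpace 𝓘(ℝ, RSpace n) x) :
    ddev dev (φ x) (mfderiv 𝓘(ℝ, RSpace n) 𝓘(ℝ, RSpace n) φ x v) = A.linear (ddev dev x v) := by
  have h1 := (hdev.hasMFDerivAt (φ x)).comp x hφ.hasMFDerivAt
  have h2 := (hasFDerivAt_affineMap A.toAffineMap (dev x)).hasMFDerivAt.comp x (hdev.hasMFDerivAt x)
  have h3 : dev ∘ φ = (fun y => A.toAffineMap y) ∘ dev := funext h
  rw [h3] at h1
  exact congrArg (fun L : TangentSpace 𝓘(ℝ, RSpace n) x →L[ℝ] RSpace n => L v)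
    (hasMFDerivAt_unique h1 h2)

end IsDevelopingMap

end DevelopingMaps

/-- The derivative of a pair of vector valued functions. -/
lemma hasMFDerivAt_prodMk_vectorSpace {E : Type*} [NormedAddCommGroup E] [NormedSpace ℝ E]
    {H : Type*} [TopologicalSpace H] {J : ModelWithCorners ℝ E H} {N : Type*} [TopologicalSpace N]
    [ChartedSpace H N] {F F' : Type*} [NormedAddCommGroup F] [NormedSpace ℝ F]
    [NormedAddCommGroup F'] [NormedSpace ℝ F'] {f : N → F} {f' : N → F'} {x : N}
    {L : TangentSpace J x →L[ℝ] F} {L' : TangentSpace J x →L[ℝ] F'}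
    (h : HasMFDerivAt J 𝓘(ℝ, F) f x L) (h' : HasMFDerivAt J 𝓘(ℝ, F') f' x L') :
    HasMFDerivAt J 𝓘(ℝ, F × F') (fun y => (f y, f' y)) x (L.prod L') :=
  ⟨h.1.prodMk h'.1, h.2.prodMk h'.2⟩

/-! ### The identification of the tangent bundle with the product -/

section Product

variable {n : ℕ} {M : Type*} [TopologicalSpace M] [ChartedSpace (RSpace n) M]
  [FlatAffineManifold n M] {dev : M → RSpace n}

/-- The differential of the map `dev × id : M × ℝⁿ → ℝⁿ × ℝⁿ`. -/
def dprod (dev : M → RSpace n) (q : M × RSpace n) :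
    TangentSpace (prodModel n) q →L[ℝ] RSpace n × RSpace n :=
  mfderiv (prodModel n) 𝓘(ℝ, RSpace n × RSpace n) (fun q : M × RSpace n => (dev q.1, q.2)) q

namespace IsDevelopingMap

lemma contMDiff_prod (hdev : IsDevelopingMap dev) :
    ContMDiff (prodModel n) 𝓘(ℝ, RSpace n × RSpace n) ∞
      (fun q : M × RSpace n => (dev q.1, q.2)) :=
  (hdev.contMDiff.comp contMDiff_fst).prodMk_space contMDiff_snd

lemma hasMFDerivAt_prod (hdev : IsDevelopingMap dev) (q : M × RSpace n) :
    HasMFDerivAt (prodModel n) 𝓘(ℝ, RSpace n × RSpace n)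
      (fun q : M × RSpace n => (dev q.1, q.2)) q (dprod dev q) :=
  ((hdev.contMDiff_prod q).mdifferentiableAt (by simp)).hasMFDerivAt

lemma dprod_apply (hdev : IsDevelopingMap dev) (q : M × RSpace n)
    (X : TangentSpace (prodModel n) q) :
    dprod dev q X = (ddev dev q.1 (mfderiv (prodModel n) 𝓘(ℝ, RSpace n) Prod.fst q X),
      mfderiv (prodModel n) 𝓘(ℝ, RSpace n) (Prod.snd : M × RSpace n → RSpace n) q X) := by
  have h1 : HasMFDerivAt (prodModel n) 𝓘(ℝ, RSpace n) (Prod.fst : M × RSpace n → M) q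
      (mfderiv (prodModel n) 𝓘(ℝ, RSpace n) Prod.fst q) := mdifferentiableAt_fst.hasMFDerivAt
  have h2 : HasMFDerivAt (prodModel n) 𝓘(ℝ, RSpace n) (Prod.snd : M × RSpace n → RSpace n) q
      (mfderiv (prodModel n) 𝓘(ℝ, RSpace n) Prod.snd q) := mdifferentiableAt_snd.hasMFDerivAt
  have h4 := (hdev.hasMFDerivAt q.1).comp q h1
  have h3 := hasMFDerivAt_prodMk_vectorSpace h4 h2
  exact congrArg (fun L : TangentSpace (prodModel n) q →L[ℝ] RSpace n × RSpace n => L X)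
    (hasMFDerivAt_unique (hdev.hasMFDerivAt_prod q) h3)

lemma dprod_mk (hdev : IsDevelopingMap dev) (q : M × RSpace n)
    (v : TangentSpace 𝓘(ℝ, RSpace n) q.1) (w : RSpace n) :
    dprod dev q (show TangentSpace (prodModel n) q from (v, w)) = (ddev dev q.1 v, w) := by
  rw [hdev.dprod_apply, mfderiv_fst, mfderiv_snd]
  rfl

lemma inverse_ddev_dprod_fst (hdev : IsDevelopingMap dev) (q : M × RSpace n)
    (X : TangentSpace (prodModel n) q) :
    (ddev dev q.1).inverse (dprod dev q X).1
      = mfderiv (prodModel n) 𝓘(ℝ, RSpace n) Prod.fst q X := by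
  rw [hdev.dprod_apply]
  exact hdev.inverse_ddev _ _

lemma dprod_injective (hdev : IsDevelopingMap dev) (q : M × RSpace n) :
    Function.Injective (dprod dev q) := by
  intro X Y h
  have h1 := hdev.inverse_ddev_dprod_fst q X
  rw [h, hdev.inverse_ddev_dprod_fst q Y, mfderiv_fst] at h1
  have h2 := congrArg Prod.snd h
  rw [hdev.dprod_apply, hdev.dprod_apply, mfderiv_snd] at h2
  exact Prod.ext h1.symm h2

lemma dprod_surjective (hdev : IsDevelopingMap dev) (q : M × RSpace n) :
    Function.Surjective (dprod dev q) := by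
  rintro ⟨v, w⟩
  refine ⟨show TangentSpace (prodModel n) q from ((ddev dev q.1).inverse v, w), ?_⟩
  rw [hdev.dprod_mk, hdev.ddev_inverse]

lemma dprod_isInvertible (hdev : IsDevelopingMap dev) (q : M × RSpace n) :
    (dprod dev q).IsInvertible :=
  ⟨ContinuousLinearEquiv.ofBijective (E := RSpace n × RSpace n) (dprod dev q)
    (LinearMap.ker_eq_bot.2 (hdev.dprod_injective q))
    (LinearMap.range_eq_top.2 (hdev.dprod_surjective q)), by
      exact ContinuousLinearEquiv.coe_ofBijective (E := RSpace n × RSpace n) _ _ _⟩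

/-- In developed coordinates `I` is a constant rotation. As `dprod` is injective, identities about
`I` reduce to this formula. -/
lemma dprod_complexI (hdev : IsDevelopingMap dev) (q : M × RSpace n)
    (X : TangentSpace (prodModel n) q) :
    dprod dev q (complexI dev q X) = (-(dprod dev q X).2, (dprod dev q X).1) := by
  have h1 : complexI dev q X = (show TangentSpace (prodModel n) q from
      (-(ddev dev q.1).inverse (dprod dev q X).2, (dprod dev q X).1)) := by
    rw [hdev.dprod_apply q X, mfderiv_fst, mfderiv_snd]
    rfl
  rw [h1, hdev.dprod_mk]
  refine Prod.ext ?_ rfl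
  exact (map_neg (ddev dev q.1) _).trans (congrArg Neg.neg (hdev.ddev_inverse q.1 _))

end IsDevelopingMap

/-- The metric `g`, transported to `ℝⁿ` at each point by the differential of `dev`. -/
def devMetric (g : Metric n M) (dev : M → RSpace n) (x : M) : RSpace n →L[ℝ] RSpace n →L[ℝ] ℝ :=
  ContinuousLinearMap.bilinearComp (E := RSpace n) (F := RSpace n) (g.inner x)
    (ddev dev x).inverse (ddev dev x).inverse

lemma devMetric_apply (g : Metric n M) (x : M) (v w : RSpace n) :
    devMetric g dev x v w = g.inner x ((ddev dev x).inverse v) ((ddev dev x).inverse w) := rfl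

lemma devMetric_symm (g : Metric n M) (x : M) (v w : RSpace n) :
    devMetric g dev x v w = devMetric g dev x w v := g.symm x _ _

namespace IsDevelopingMap

lemma inner_eq_devMetric (hdev : IsDevelopingMap dev) (g : Metric n M) (x : M)
    (v w : TangentSpace 𝓘(ℝ, RSpace n) x) :
    g.inner x v w = devMetric g dev x (ddev dev x v) (ddev dev x w) := by
  rw [devMetric_apply, hdev.inverse_ddev, hdev.inverse_ddev]

lemma metricR_eq (hdev : IsDevelopingMap dev) (g : Metric n M) (q : M × RSpace n)
    (X Y : TangentSpace (prodModel n) q) :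
    metricR g dev q X Y = devMetric g dev q.1 (dprod dev q X).1 (dprod dev q Y).1
      + devMetric g dev q.1 (dprod dev q X).2 (dprod dev q Y).2 := by
  have key : ∀ X Y : TangentSpace (prodModel n) q, pullbackMetric g q X Y
      = devMetric g dev q.1 (dprod dev q X).1 (dprod dev q Y).1 := by
    intro X Y
    rw [devMetric_apply, hdev.inverse_ddev_dprod_fst, hdev.inverse_ddev_dprod_fst]
    rfl
  rw [metricR, key, key, hdev.dprod_complexI, hdev.dprod_complexI]
  simp

lemma omegaR_eq (hdev : IsDevelopingMap dev) (g : Metric n M) (q : M × RSpace n)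
    (X Y : TangentSpace (prodModel n) q) :
    omegaR g dev q X Y = devMetric g dev q.1 (dprod dev q X).1 (dprod dev q Y).2
      - devMetric g dev q.1 (dprod dev q X).2 (dprod dev q Y).1 := by
  rw [omegaR, hdev.metricR_eq, hdev.dprod_complexI]
  simp
  ring

/-- The trivialization of `TM` at `x` is the differential of the chart, so composing with the linear
part of `A` gives the differential of `dev` at all nearby points, with one and the same `A`. -/
lemma eventually_trivializationAt_eq (hdev : IsDevelopingMap dev) (x : M) :
    ∃ A : RSpace n ≃ᵃ[ℝ] RSpace n, (∀ᶠ y in 𝓝 x, dev y = A (chartAt (RSpace n) x y)) ∧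
      ∀ᶠ y in 𝓝 x, ∀ v : TangentSpace 𝓘(ℝ, RSpace n) y,
        ddev dev y v = A.linear (trivializationAt (RSpace n)
          (TangentSpace 𝓘(ℝ, RSpace n) : M → Type _) x ⟨y, v⟩).2 := by
  obtain ⟨A, hA⟩ := hdev x
  refine ⟨A, hA, ?_⟩
  filter_upwards [eventually_eventually_nhds.2 hA,
    (chartAt (RSpace n) x).open_source.mem_nhds (mem_chart_source _ x)] with y hy hy' v
  rw [ddev_eq hy' hy]
  congr 1
  have h1 := TangentBundle.continuousLinearMapAt_trivializationAt (I := 𝓘(ℝ, RSpace n))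
    (x₀ := x) (x := y) hy'
  have h2 := congrArg (fun L => L v) h1
  refine h2.symm.trans ?_
  exact Bundle.Trivialization.continuousLinearMapAt_apply_of_mem (R := ℝ) _ hy' v

/-- The identification of `TM` with `M × ℝⁿ` defined by a development map. -/
def tangentDiffeomorph (hdev : IsDevelopingMap dev) :
    Diffeomorph 𝓘(ℝ, RSpace n).tangent (prodModel n)
      (TangentBundle 𝓘(ℝ, RSpace n) M) (M × RSpace n) ∞ where
  toFun p := (p.proj, ddev dev p.proj p.snd)
  invFun q := ⟨q.1, (ddev dev q.1).inverse q.2⟩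
  left_inv p := by
    simp only [hdev.inverse_ddev]
  right_inv q := Prod.ext rfl (hdev.ddev_inverse q.1 q.2)
  contMDiff_toFun p := by
    obtain ⟨A, -, hA⟩ := hdev.eventually_trivializationAt_eq p.proj
    have h0 : ContMDiff 𝓘(ℝ, RSpace n).tangent 𝓘(ℝ, RSpace n) ∞
        (fun p : TangentBundle 𝓘(ℝ, RSpace n) M => p.proj) :=
      Bundle.contMDiff_proj (TangentSpace 𝓘(ℝ, RSpace n))
    refine (h0 p).prodMk ?_
    have h1 := (Bundle.contMDiffAt_totalSpace (F := RSpace n)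
      (E := (TangentSpace 𝓘(ℝ, RSpace n) : M → Type _)) (IB := 𝓘(ℝ, RSpace n))
      (IM := 𝓘(ℝ, RSpace n).tangent) (n := ∞) (x₀ := p) (f := id)).1 contMDiffAt_id
    have h2 := (A.linear.toContinuousLinearEquiv.contDiff (n := ∞)).contMDiff.contMDiffAt.comp p h1.2
    refine h2.congr_of_eventuallyEq ?_
    filter_upwards [(h0 p).continuousAt.eventually hA] with p' hp'
    exact hp' p'.snd
  contMDiff_invFun q := by
    obtain ⟨A, -, hA⟩ := hdev.eventually_trivializationAt_eq q.1
    refine Bundle.contMDiffAt_totalSpace.2 ⟨contMDiffAt_fst, ?_⟩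
    have h2 := (A.linear.toContinuousLinearEquiv.symm.contDiff (n := ∞)).contMDiff.contMDiffAt.comp q
      (contMDiffAt_snd (I := 𝓘(ℝ, RSpace n)) (J := 𝓘(ℝ, RSpace n)) (n := ∞) (M := M) (p := q))
    refine h2.congr_of_eventuallyEq ?_
    filter_upwards [continuousAt_fst.eventually hA] with q' hq'
    have := hq' ((ddev dev q'.1).inverse q'.2)
    rw [hdev.ddev_inverse] at this
    exact (A.linear.toContinuousLinearEquiv.symm_apply_eq.2 this).symm

/-- In bundle coordinates the identification is `(x, y) ↦ (A x, L y)` with `L` the linear part of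
`A`. Its derivative applies the same `L` to both factors, so it commutes with the rotation and
carries `gʳ` to `gʳ`. -/
lemma dprod_mfderiv_tangentDiffeomorph (hdev : IsDevelopingMap dev)
    (p : TangentBundle 𝓘(ℝ, RSpace n) M) :
    ∃ L : RSpace n ≃L[ℝ] RSpace n,
      (∀ v : TangentSpace 𝓘(ℝ, RSpace n) p.proj, ddev dev p.proj v = L (dchart p.proj p.proj v)) ∧
      ∀ X, dprod dev (hdev.tangentDiffeomorph p)
          (mfderiv 𝓘(ℝ, RSpace n).tangent (prodModel n) hdev.tangentDiffeomorph p X)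
        = (L (dxy p X).1, L (dxy p X).2) := by
  obtain ⟨A, hA1, hA⟩ := hdev.eventually_trivializationAt_eq p.proj
  refine ⟨A.linear.toContinuousLinearEquiv, fun v => ddev_eq (mem_chart_source _ _) hA1 v,
    fun X => ?_⟩
  have hτ := (hdev.tangentDiffeomorph.contMDiff.contMDiffAt (x := p)).mdifferentiableAt
    (by simp)
  have h1 := (hdev.hasMFDerivAt_prod (hdev.tangentDiffeomorph p)).comp p hτ.hasMFDerivAt
  have hx : HasMFDerivAt 𝓘(ℝ, RSpace n).tangent 𝓘(ℝ, RSpace n × RSpace n)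
      (extChartAt 𝓘(ℝ, RSpace n).tangent p) p (dxy p) :=
    (mdifferentiableAt_extChartAt (mem_chart_source _ p)).hasMFDerivAt
  have h2 := ((hasFDerivAt_affineMap A.toAffineMap (extChartAt 𝓘(ℝ, RSpace n).tangent p p).1).prodMap
    (extChartAt 𝓘(ℝ, RSpace n).tangent p p)
      A.linear.toContinuousLinearEquiv.toContinuousLinearMap.hasFDerivAt).hasMFDerivAt.comp p hx
  have h3 : (fun q : M × RSpace n => (dev q.1, q.2)) ∘ hdev.tangentDiffeomorph =ᶠ[𝓝 p]
      Prod.map (fun y => A.toAffineMap y) A.linear.toContinuousLinearEquiv.toContinuousLinearMap ∘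
        extChartAt 𝓘(ℝ, RSpace n).tangent p := by
    have h0 : Continuous (fun p : TangentBundle 𝓘(ℝ, RSpace n) M => p.proj) :=
      FiberBundle.continuous_proj (RSpace n) (TangentSpace 𝓘(ℝ, RSpace n))
    filter_upwards [h0.continuousAt.eventually hA, h0.continuousAt.eventually hA1] with p' hp hp'
    rw [FiberBundle.extChartAt]
    exact Prod.ext hp' (hp p'.snd)
  have h4 := hasMFDerivAt_unique h1 (h2.congr_of_eventuallyEq h3)
  exact congrArg (fun L : TangentSpace 𝓘(ℝ, RSpace n).tangent p →L[ℝ] RSpace n × RSpace n => L X) h4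

lemma tangentDiffeomorph_complexTM (hdev : IsDevelopingMap dev)
    (p : TangentBundle 𝓘(ℝ, RSpace n) M) (X : TangentSpace 𝓘(ℝ, RSpace n).tangent p) :
    mfderiv 𝓘(ℝ, RSpace n).tangent (prodModel n) hdev.tangentDiffeomorph p (complexTM p X)
      = complexI dev (hdev.tangentDiffeomorph p)
        (mfderiv 𝓘(ℝ, RSpace n).tangent (prodModel n) hdev.tangentDiffeomorph p X) := by
  obtain ⟨L, -, hL⟩ := hdev.dprod_mfderiv_tangentDiffeomorph p
  have hi : (dxy p).IsInvertible := isInvertible_mfderiv_extChartAt (mem_extChartAt_source p)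
  have h1 : dxy p (complexTM p X) = (-(dxy p X).2, (dxy p X).1) := hi.self_apply_inverse _
  apply hdev.dprod_injective
  rw [hdev.dprod_complexI, hL, hL, h1]
  simp

lemma tangentDiffeomorph_metricTM (hdev : IsDevelopingMap dev) (g : Metric n M)
    (p : TangentBundle 𝓘(ℝ, RSpace n) M) (X Y : TangentSpace 𝓘(ℝ, RSpace n).tangent p) :
    metricR g dev (hdev.tangentDiffeomorph p)
        (mfderiv 𝓘(ℝ, RSpace n).tangent (prodModel n) hdev.tangentDiffeomorph p X)
        (mfderiv 𝓘(ℝ, RSpace n).tangent (prodModel n) hdev.tangentDiffeomorph p Y)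
      = metricTM g p X Y := by
  obtain ⟨L, hL', hL⟩ := hdev.dprod_mfderiv_tangentDiffeomorph p
  have hi := dchart_isInvertible (n := n) (mem_chart_source (RSpace n) p.proj)
  have h1 : ∀ v : RSpace n, (ddev dev p.proj).inverse (L v) = (dchart p.proj p.proj).inverse v := by
    intro v
    rw [← hdev.inverse_ddev p.proj ((dchart p.proj p.proj).inverse v), hL',
      hi.self_apply_inverse]
  rw [hdev.metricR_eq, hL, hL, metricTM, devMetric_apply, devMetric_apply]
  change g.inner p.proj ((ddev dev p.proj).inverse _) ((ddev dev p.proj).inverse _)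
    + g.inner p.proj ((ddev dev p.proj).inverse _) ((ddev dev p.proj).inverse _) = _
  simp only [h1]

end IsDevelopingMap

end Product

/-! ### Smooth sections and vector valued differentials -/

section Smoothness

/-- A map to a space of linear maps on a finite dimensional space is smooth if its evaluations
are. -/
lemma contMDiffAt_clm_of_apply {E : Type*} [NormedAddCommGroup E] [NormedSpace ℝ E]
    {H : Type*} [TopologicalSpace H] {J : ModelWithCorners ℝ E H} {N : Type*} [TopologicalSpace N]
    [ChartedSpace H N] {F F' : Type*} [NormedAddCommGroup F] [NormedSpace ℝ F]
    [FiniteDimensional ℝ F] [NormedAddCommGroup F'] [NormedSpace ℝ F'] {k : WithTop ℕ∞}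
    {f : N → F →L[ℝ] F'} {x : N} (h : ∀ v, ContMDiffAt J 𝓘(ℝ, F') k (fun y => f y v) x) :
    ContMDiffAt J 𝓘(ℝ, F →L[ℝ] F') k f x := by
  have hd : Module.finrank ℝ F = Module.finrank ℝ (Fin (Module.finrank ℝ F) → ℝ) :=
    (Module.finrank_fin_fun ℝ).symm
  let e₁ := ContinuousLinearEquiv.ofFinrankEq hd
  let e₂ := (e₁.arrowCongr (1 : F' ≃L[ℝ] F')).trans
    (ContinuousLinearEquiv.piRing (Fin (Module.finrank ℝ F)))
  have h1 : ContMDiffAt J 𝓘(ℝ, Fin (Module.finrank ℝ F) → F') k (e₂ ∘ f) x :=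
    contMDiffAt_pi_space.2 fun i => h _
  have h2 := (e₂.symm.contDiff (n := k)).contMDiff.contMDiffAt.comp x h1
  refine h2.congr_of_eventuallyEq (Filter.Eventually.of_forall fun y => ?_)
  simp

variable {F : Type*} [NormedAddCommGroup F] [NormedSpace ℝ F] {H : Type*} [TopologicalSpace H]
  {J : ModelWithCorners ℝ F H} {N : Type*} [TopologicalSpace N] [ChartedSpace H N]

/-- The product rule for the evaluation of a family of linear maps. -/
lemma hasMFDerivAt_clm_apply {E E' : Type*} [NormedAddCommGroup E] [NormedSpace ℝ E]
    [NormedAddCommGroup E'] [NormedSpace ℝ E'] {c : N → E →L[ℝ] E'} {u : N → E} {x : N}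
    {c' : TangentSpace J x →L[ℝ] E →L[ℝ] E'} {u' : TangentSpace J x →L[ℝ] E}
    (hc : HasMFDerivAt J 𝓘(ℝ, E →L[ℝ] E') c x c') (hu : HasMFDerivAt J 𝓘(ℝ, E) u x u') :
    ∃ D : TangentSpace J x →L[ℝ] E', HasMFDerivAt J 𝓘(ℝ, E') (fun y => c y (u y)) x D ∧
      ∀ v, D v = c x (u' v) + c' v (u x) := by
  have h1 := (isBoundedBilinearMap_apply (𝕜 := ℝ) (E := E) (F := E')).hasFDerivAt (c x, u x)
  have h2 := h1.hasMFDerivAt.comp x (hasMFDerivAt_prodMk_vectorSpace hc hu)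
  exact ⟨_, h2, fun v => rfl⟩

/-- The product rule for the evaluation of a family of bilinear forms. -/
lemma hasMFDerivAt_clm_apply₂ {E : Type*} [NormedAddCommGroup E] [NormedSpace ℝ E]
    {c : N → E →L[ℝ] E →L[ℝ] ℝ} {u w : N → E} {x : N}
    {c' : TangentSpace J x →L[ℝ] E →L[ℝ] E →L[ℝ] ℝ} {u' w' : TangentSpace J x →L[ℝ] E}
    (hc : HasMFDerivAt J 𝓘(ℝ, E →L[ℝ] E →L[ℝ] ℝ) c x c') (hu : HasMFDerivAt J 𝓘(ℝ, E) u x u')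
    (hw : HasMFDerivAt J 𝓘(ℝ, E) w x w') :
    ∃ D : TangentSpace J x →L[ℝ] ℝ,
      HasMFDerivAt J 𝓘(ℝ, ℝ) (fun y => c y (u y) (w y)) x D ∧
      ∀ v, D v = c' v (u x) (w x) + c x (u' v) (w x) + c x (u x) (w' v) := by
  obtain ⟨D₁, h1, hD₁⟩ := hasMFDerivAt_clm_apply hc hu
  obtain ⟨D₂, h2, hD₂⟩ := hasMFDerivAt_clm_apply h1 hw
  refine ⟨D₂, h2, fun v => ?_⟩
  rw [hD₂, hD₁]
  simp
  ring

lemma hasMFDerivAt_clm_apply_const₂ {E : Type*} [NormedAddCommGroup E] [NormedSpace ℝ E]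
    {c : N → E →L[ℝ] E →L[ℝ] ℝ} {x : N} {c' : TangentSpace J x →L[ℝ] E →L[ℝ] E →L[ℝ] ℝ}
    (hc : HasMFDerivAt J 𝓘(ℝ, E →L[ℝ] E →L[ℝ] ℝ) c x c') (u w : E) :
    ∃ D : TangentSpace J x →L[ℝ] ℝ,
      HasMFDerivAt J 𝓘(ℝ, ℝ) (fun y => c y u w) x D ∧ ∀ v, D v = c' v u w := by
  obtain ⟨D, h, hD⟩ := hasMFDerivAt_clm_apply₂ hc (hasMFDerivAt_const u x)
    (hasMFDerivAt_const w x)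
  refine ⟨D, h, fun v => (hD v).trans ?_⟩
  change c' v u w + c x (0 : E) w + c x u (0 : E) = _
  simp

variable [IsManifold J ∞ N]

/-- The differential of a smooth vector valued function, applied to a smooth vector field, is
smooth. -/
lemma SmoothFieldAt.mfderiv_apply {F' : Type*} [NormedAddCommGroup F'] [NormedSpace ℝ F']
    {f : N → F'} (hf : ContMDiff J 𝓘(ℝ, F') ∞ f) {X : (x : N) → TangentSpace J x} {x : N}
    (hX : SmoothFieldAt J X x) :
    ContMDiffAt J 𝓘(ℝ, F') ∞ (fun y => (mfderiv J 𝓘(ℝ, F') f y (X y) : F')) x := by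
  have h1 : ContMDiff J.tangent 𝓘(ℝ, F').tangent ∞ (tangentMap J 𝓘(ℝ, F') f) :=
    hf.contMDiff_tangentMap (by simp)
  have h2 := (h1.contMDiffAt (x := ⟨x, X x⟩)).comp x hX
  exact ((contMDiff_snd_tangentBundle_modelSpace F' 𝓘(ℝ, F')).contMDiffAt).comp x h2

/-- The local frame of the tangent bundle given by a chart is smooth. -/
lemma smoothFieldAt_trivializationAt_symm (x : N) (v : F) :
    SmoothFieldAt J (fun y => (trivializationAt F (TangentSpace J : N → Type _) x).symm y v) x := by
  refine (Bundle.contMDiffAt_section (F := F) x).2 ?_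
  refine (contMDiffAt_const (c := v)).congr_of_eventuallyEq ?_
  filter_upwards [(trivializationAt F (TangentSpace J : N → Type _) x).open_baseSet.mem_nhds
    (mem_baseSet_trivializationAt F _ x)] with y hy
  rw [Bundle.Trivialization.apply_mk_symm _ hy]

/-- A bilinear form on a manifold is smooth if its values on local frames are. -/
lemma contMDiffAt_bilinear_of_frame [FiniteDimensional ℝ F]
    {b : (x : N) → TangentSpace J x →L[ℝ] TangentSpace J x →L[ℝ] ℝ} {x : N}
    (h : ∀ v w : F, ContMDiffAt J 𝓘(ℝ, ℝ) ∞ (fun y => b y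
      ((trivializationAt F (TangentSpace J : N → Type _) x).symm y v)
      ((trivializationAt F (TangentSpace J : N → Type _) x).symm y w)) x) :
    ContMDiffAt J (J.prod 𝓘(ℝ, F →L[ℝ] F →L[ℝ] ℝ)) ∞
      (fun y => TotalSpace.mk' (F →L[ℝ] F →L[ℝ] ℝ)
        (E := fun x : N => TangentSpace J x →L[ℝ] TangentSpace J x →L[ℝ] ℝ) y (b y)) x := by
  refine (contMDiffAt_hom_bundle _).2 ⟨contMDiffAt_id, ?_⟩
  refine contMDiffAt_clm_of_apply fun v => contMDiffAt_clm_of_apply fun w => ?_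
  refine (h v w).congr_of_eventuallyEq ?_
  filter_upwards [(trivializationAt F (TangentSpace J : N → Type _) x).open_baseSet.mem_nhds
    (mem_baseSet_trivializationAt F _ x)] with y hy
  refine (inCoordinates_apply_eq₂ (E₃ := Bundle.Trivial N ℝ) hy hy (Set.mem_univ _)).trans ?_
  simp

end Smoothness

/-! ### The metric in developed coordinates and its first derivative -/

section DevMetric

variable {n : ℕ} {M : Type*} [TopologicalSpace M] [ChartedSpace (RSpace n) M]
  [FlatAffineManifold n M] {dev : M → RSpace n}

namespace IsDevelopingMap

/-- The vector fields which are constant with respect to a development map are smooth. -/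
lemma smoothFieldAt_inverse_ddev (hdev : IsDevelopingMap dev) (v : RSpace n) (x : M) :
    SmoothFieldAt 𝓘(ℝ, RSpace n) (fun y => (ddev dev y).inverse v) x := by
  have h1 : ContMDiff 𝓘(ℝ, RSpace n) (prodModel n) ∞ (fun y : M => (y, v)) :=
    contMDiff_id.prodMk contMDiff_const
  exact (hdev.tangentDiffeomorph.symm.contMDiff.comp h1) x

end IsDevelopingMap

/-- A smooth Riemannian metric, applied to smooth fields, is smooth. -/
lemma contMDiffAt_inner (g : Metric n M) {X Y : (x : M) → TangentSpace 𝓘(ℝ, RSpace n) x} {x : M}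
    (hX : SmoothFieldAt 𝓘(ℝ, RSpace n) X x) (hY : SmoothFieldAt 𝓘(ℝ, RSpace n) Y x) :
    ContMDiffAt 𝓘(ℝ, RSpace n) 𝓘(ℝ, ℝ) ∞ (fun y => g.inner y (X y) (Y y)) x := by
  have h1 : ContMDiffAt 𝓘(ℝ, RSpace n) (𝓘(ℝ, RSpace n).prod 𝓘(ℝ)) ∞
      (fun m ↦ TotalSpace.mk' ℝ (E := Bundle.Trivial M ℝ) m (g.inner m (X m) (Y m))) x :=
    ContMDiffAt.clm_bundle_apply₂ (F₁ := RSpace n) (F₂ := RSpace n) (g.contMDiff x) hX hY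
  exact ((Bundle.contMDiffAt_totalSpace).1 h1).2

namespace IsDevelopingMap

lemma contMDiff_devMetric (hdev : IsDevelopingMap dev) (g : Metric n M) :
    ContMDiff 𝓘(ℝ, RSpace n) 𝓘(ℝ, RSpace n →L[ℝ] RSpace n →L[ℝ] ℝ) ∞ (devMetric g dev) := by
  intro x
  refine contMDiffAt_clm_of_apply fun v => contMDiffAt_clm_of_apply fun w => ?_
  exact contMDiffAt_inner g (hdev.smoothFieldAt_inverse_ddev v x)
    (hdev.smoothFieldAt_inverse_ddev w x)

lemma hasMFDerivAt_devMetric (hdev : IsDevelopingMap dev) (g : Metric n M) (x : M) :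
    HasMFDerivAt 𝓘(ℝ, RSpace n) 𝓘(ℝ, RSpace n →L[ℝ] RSpace n →L[ℝ] ℝ) (devMetric g dev) x
      (mfderiv 𝓘(ℝ, RSpace n) 𝓘(ℝ, RSpace n →L[ℝ] RSpace n →L[ℝ] ℝ) (devMetric g dev) x) :=
  ((hdev.contMDiff_devMetric g x).mdifferentiableAt (by simp)).hasMFDerivAt

end IsDevelopingMap

/-- The derivative `∂_a g(b, c)` of the metric in the flat coordinates given by `dev`. -/
def devCubic (g : Metric n M) (dev : M → RSpace n) (x : M) (a b c : RSpace n) : ℝ :=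
  (show RSpace n →L[ℝ] RSpace n →L[ℝ] ℝ from mfderiv 𝓘(ℝ, RSpace n)
    𝓘(ℝ, RSpace n →L[ℝ] RSpace n →L[ℝ] ℝ) (devMetric g dev) x ((ddev dev x).inverse a)) b c

namespace IsDevelopingMap

/-- Identifies the cubic form with derivatives of scalar functions, so that its symmetries can be
read off from those functions. -/
lemma exists_hasMFDerivAt_devMetric_apply (hdev : IsDevelopingMap dev) (g : Metric n M) (x : M)
    (b c : RSpace n) :
    ∃ D : TangentSpace 𝓘(ℝ, RSpace n) x →L[ℝ] ℝ,
      HasMFDerivAt 𝓘(ℝ, RSpace n) 𝓘(ℝ, ℝ) (fun y => devMetric g dev y b c) x D ∧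
      ∀ a, D ((ddev dev x).inverse a) = devCubic g dev x a b c := by
  obtain ⟨D, hD, hD'⟩ := hasMFDerivAt_clm_apply_const₂ (hdev.hasMFDerivAt_devMetric g x) b c
  exact ⟨D, hD, fun a => hD' _⟩

lemma devCubic_swap_right (hdev : IsDevelopingMap dev) (g : Metric n M) (x : M)
    (a b c : RSpace n) : devCubic g dev x a b c = devCubic g dev x a c b := by
  obtain ⟨D, h1, hD⟩ := hdev.exists_hasMFDerivAt_devMetric_apply g x b c
  obtain ⟨D', h2, hD'⟩ := hdev.exists_hasMFDerivAt_devMetric_apply g x c b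
  have h3 : (fun y => devMetric g dev y b c) = fun y => devMetric g dev y c b :=
    funext fun y => devMetric_symm g y b c
  rw [h3] at h1
  rw [← hD, ← hD', hasMFDerivAt_unique h1 h2]

/-- Here the Hessian condition enters: in flat coordinates `g = D²φ`, so the cubic form is `D³φ`,
and its first two arguments commute by the symmetry of the second derivative of `Dφ`. -/
lemma devCubic_swap_left (hdev : IsDevelopingMap dev) {g : Metric n M} (hg : IsHessianMetric g)
    (x : M) (a b c : RSpace n) : devCubic g dev x a b c = devCubic g dev x b a c := by
  obtain ⟨V, φ, hV, hxV, hφ, hgφ⟩ := hg x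
  obtain ⟨A, hA⟩ := hdev x
  let L := A.linear.toContinuousLinearEquiv
  have hD : ∀ y ∈ (chartAt (RSpace n) x).source,
      (∀ᶠ z in 𝓝 y, dev z = A (chartAt (RSpace n) x z)) → ∀ v : RSpace n,
        dchart x y ((ddev dev y).inverse v) = L.symm v := by
    intro y hy hy' v
    rw [ContinuousLinearEquiv.eq_symm_apply]
    exact (ddev_eq hy hy' _).symm.trans (hdev.ddev_inverse y v)
  have hφ2 : ContDiffAt ℝ ∞ (fderiv ℝ φ) (chartAt (RSpace n) x x) :=
    ((hφ.contDiffAt (hV.mem_nhds hxV)).fderiv_right (m := ∞) (by simp))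
  have hφ3 : DifferentiableAt ℝ (fderiv ℝ (fderiv ℝ φ)) (chartAt (RSpace n) x x) :=
    ((hφ2.fderiv_right (m := ∞) (by simp)).differentiableAt (by simp))
  have hchart : HasMFDerivAt 𝓘(ℝ, RSpace n) 𝓘(ℝ, RSpace n) (chartAt (RSpace n) x) x (dchart x x) :=
    ((contMDiffAt_of_mem_maximalAtlas (n := ∞) (IsManifold.chart_mem_maximalAtlas x)
      (mem_chart_source _ x)).mdifferentiableAt (by simp)).hasMFDerivAt
  have key : ∀ a b c : RSpace n, devCubic g dev x a b c
      = fderiv ℝ (fderiv ℝ (fderiv ℝ φ)) (chartAt (RSpace n) x x) (L.symm a) (L.symm b)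
        (L.symm c) := by
    intro a b c
    obtain ⟨D, h1, hD'⟩ := hdev.exists_hasMFDerivAt_devMetric_apply g x b c
    have h2 : HasMFDerivAt 𝓘(ℝ, RSpace n) 𝓘(ℝ, RSpace n →L[ℝ] RSpace n →L[ℝ] ℝ)
        (fderiv ℝ (fderiv ℝ φ)) (chartAt (RSpace n) x x) _ := hφ3.hasFDerivAt.hasMFDerivAt
    obtain ⟨D₂, h3, hD₂⟩ := hasMFDerivAt_clm_apply_const₂ (h2.comp x hchart) (L.symm b) (L.symm c)
    have h4 := hasMFDerivAt_unique h1 (h3.congr_of_eventuallyEq ?_)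
    · rw [← hD', h4, hD₂, ← hD x (mem_chart_source _ x) hA a]
      rfl
    · filter_upwards [eventually_eventually_nhds.2 hA,
        (chartAt (RSpace n) x).open_source.mem_nhds (mem_chart_source _ x),
        ((chartAt (RSpace n) x).continuousAt (mem_chart_source _ x)).eventually
          (hV.mem_nhds hxV)] with y h1 h2 h3
      rw [devMetric_apply, hgφ y h2 h3, hD y h2 h1, hD y h2 h1]
      rfl
  rw [key, key]
  have := hφ2.isSymmSndFDerivAt (by simp; exact WithTop.coe_le_coe.2 le_top)
  rw [this.eq]

end IsDevelopingMap

end DevMetric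

/-! ### Lie brackets and vector valued functions -/

section Bracket

variable {F : Type*} [NormedAddCommGroup F] [NormedSpace ℝ F]
  {H : Type*} [TopologicalSpace H]
  {J : ModelWithCorners ℝ F H} [J.Boundaryless] {N : Type*} [TopologicalSpace N] [ChartedSpace H N]
  {F' : Type*} [NormedAddCommGroup F'] [NormedSpace ℝ F']

variable (J) in
/-- The differential of a vector valued function. -/
def vecDeriv (f : N → F') (x : N) : TangentSpace J x →L[ℝ] F' :=
  mfderiv J 𝓘(ℝ, F') f x

lemma mfderiv_eq_fderiv_extChartAt {f : N → F'} {x : N} (hf : MDifferentiableAt J 𝓘(ℝ, F') f x) :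
    mfderiv J 𝓘(ℝ, F') f x = fderiv ℝ (f ∘ (extChartAt J x).symm) (extChartAt J x x) := by
  rw [hf.mfderiv, J.range_eq_univ, fderivWithin_univ]
  rfl

variable [IsManifold J ∞ N] [CompleteSpace F]

/-- The differential of a function evaluated at a Lie bracket. -/
lemma vecDeriv_mlieBracket {f : N → F'} (hf : ContMDiff J 𝓘(ℝ, F') ∞ f)
    {X Y : (x : N) → TangentSpace J x} {x : N} (hX : SmoothFieldAt J X x)
    (hY : SmoothFieldAt J Y x) :
    vecDeriv J f x (VectorField.mlieBracket J X Y x)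
      = vecDeriv J (fun y => vecDeriv J f y (Y y)) x (X x)
        - vecDeriv J (fun y => vecDeriv J f y (X y)) x (Y x) := by
  have hr : Set.range J = Set.univ := J.range_eq_univ
  set z₀ := extChartAt J x x with hz₀
  set fh : F → F' := f ∘ (extChartAt J x).symm with hfh
  -- the fields in coordinates
  let hat : ((x : N) → TangentSpace J x) → F → F := fun X =>
    VectorField.mpullbackWithin 𝓘(ℝ, F) J (extChartAt J x).symm X (Set.range J)
  have hfh' : ContDiffAt ℝ ∞ fh z₀ := by
    have h1 := (contMDiffOn_extChartAt_symm (I := J) (n := ∞) x).contMDiffAt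
      ((isOpen_extChartAt_target x).mem_nhds (mem_extChartAt_target x))
    exact ((hf.contMDiffAt (x := _)).comp _ h1).contDiffAt
  have hhat : ∀ {X : (x : N) → TangentSpace J x}, SmoothFieldAt J X x →
      DifferentiableAt ℝ (hat X) z₀ := by
    intro X hX
    have := MDifferentiableWithinAt.differentiableWithinAt_mpullbackWithin_vectorField (I := J)
      (s := Set.univ) (x := x) (V := X) (hX.mdifferentiableAt (by simp)).mdifferentiableWithinAt
    have h1 : DifferentiableWithinAt ℝ (hat X) ((extChartAt J x).symm ⁻¹' Set.univ ∩ Set.range J)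
      z₀ := this
    rwa [hr, Set.preimage_univ, Set.univ_inter, differentiableWithinAt_univ] at h1
  have hhat0 : ∀ X : (x : N) → TangentSpace J x, hat X z₀ = X x := by
    intro X
    have h1 := mfderivWithin_extChartAt_symm_inverse_apply (I := J) (x := x)
      (X ((extChartAt J x).symm z₀))
    refine Eq.trans h1 ?_
    rw [hz₀, extChartAt_to_inv]
  have key : ∀ X : (x : N) → TangentSpace J x, ∀ᶠ z in 𝓝 z₀,
      vecDeriv J f ((extChartAt J x).symm z) (X ((extChartAt J x).symm z))
        = fderiv ℝ fh z (hat X z) := by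
    intro X
    filter_upwards [(isOpen_extChartAt_target x).mem_nhds (mem_extChartAt_target (I := J) x)]
      with z hz
    have hi := isInvertible_mfderivWithin_extChartAt_symm (I := J) (x := x) hz
    have h1 := (mdifferentiableWithinAt_extChartAt_symm (I := J) (x := x) hz).hasMFDerivWithinAt
    have h2 := (hf.mdifferentiableAt (by simp) :
      MDifferentiableAt J 𝓘(ℝ, F') f ((extChartAt J x).symm z)).hasMFDerivAt
    have h3 := h2.comp_hasMFDerivWithinAt z h1
    rw [hr, hasMFDerivWithinAt_univ, ← hr] at h3
    let L : F →L[ℝ] F' := vecDeriv J f ((extChartAt J x).symm z) ∘L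
      mfderivWithin 𝓘(ℝ, F) J (extChartAt J x).symm (Set.range J) z
    have h4 : fderiv ℝ fh z = L :=
      HasFDerivAt.fderiv (f' := L) (hasMFDerivAt_iff_hasFDerivAt.1 h3)
    rw [h4]
    exact congrArg (vecDeriv J f ((extChartAt J x).symm z))
      (hi.self_apply_inverse (X ((extChartAt J x).symm z))).symm
  have key2 : ∀ {X : (x : N) → TangentSpace J x}, SmoothFieldAt J X x → ∀ u : F,
      vecDeriv J (fun y => vecDeriv J f y (X y)) x u
        = fderiv ℝ (fderiv ℝ fh) z₀ u (hat X z₀) + fderiv ℝ fh z₀ (fderiv ℝ (hat X) z₀ u) := by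
    intro X hX u
    have h0 := mfderiv_eq_fderiv_extChartAt ((hX.mfderiv_apply hf).mdifferentiableAt (by simp))
    refine (congrArg (fun L : F →L[ℝ] F' => L u) h0).trans ?_
    have h1 : (fun y => vecDeriv J f y (X y)) ∘ (extChartAt J x).symm
        =ᶠ[𝓝 z₀] fun z => fderiv ℝ fh z (hat X z) := key X
    have h2 : HasFDerivAt (fderiv ℝ fh) (fderiv ℝ (fderiv ℝ fh) z₀) z₀ :=
      ((hfh'.fderiv_right (m := ∞) (by simp)).differentiableAt (by simp)).hasFDerivAt
    change fderiv ℝ ((fun y => vecDeriv J f y (X y)) ∘ (extChartAt J x).symm) z₀ u = _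
    rw [h1.fderiv_eq, (h2.clm_apply (hhat hX).hasFDerivAt).fderiv, add_comm]
    rfl
  let W : F := VectorField.lieBracketWithin ℝ (hat X) (hat Y)
    ((extChartAt J x).symm ⁻¹' Set.univ ∩ Set.range J) z₀
  have hW : W = fderiv ℝ (hat Y) z₀ (hat X z₀) - fderiv ℝ (hat X) z₀ (hat Y z₀) := by
    simp only [W]
    rw [hr, Set.preimage_univ, Set.univ_inter, VectorField.lieBracketWithin_univ]
    rfl
  -- The tangent space at `x` is modelled through the chart at `x`, whose differential there is the
  -- identity; so the manifold bracket at `x` is the bracket in coordinates.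
  have hinv : (mfderiv J 𝓘(ℝ, F) (extChartAt J x) x).inverse = ContinuousLinearMap.id ℝ F := by
    rw [mfderiv_extChartAt_self]
    exact ContinuousLinearMap.inverse_id
  have h3 : VectorField.mlieBracket J X Y x = W := congrArg (fun L : F →L[ℝ] F => L W) hinv
  have h4 : vecDeriv J f x = fderiv ℝ fh z₀ :=
    mfderiv_eq_fderiv_extChartAt (hf.mdifferentiableAt (by simp))
  have h5 := hfh'.isSymmSndFDerivAt (by simp; exact WithTop.coe_le_coe.2 le_top)
  have k0 : vecDeriv J f x (VectorField.mlieBracket J X Y x) = fderiv ℝ fh z₀ W :=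
    (congrArg _ h3).trans (congrArg (fun L : F →L[ℝ] F' => L W) h4)
  have k1 := (congrArg (vecDeriv J (fun y => vecDeriv J f y (Y y)) x) (hhat0 X).symm).trans
    (key2 hY (hat X z₀))
  have k2 := (congrArg (vecDeriv J (fun y => vecDeriv J f y (X y)) x) (hhat0 Y).symm).trans
    (key2 hX (hat Y z₀))
  -- The two second-derivative terms cancel by symmetry; what is left is `D fh` of the coordinate
  -- bracket.
  rw [k0, k1, k2, hW, map_sub, h5.eq (hat X z₀) (hat Y z₀)]
  abel

end Bracket

/-! ### The Kähler structure on the product -/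

section Kahler

variable {n : ℕ} {M : Type*} [TopologicalSpace M] [ChartedSpace (RSpace n) M]
  [FlatAffineManifold n M] {dev : M → RSpace n}

/-- The form `ω` in the flat coordinates given by a development map. -/
def devForm (g : Metric n M) (dev : M → RSpace n) (q : M × RSpace n) :
    RSpace n × RSpace n →L[ℝ] RSpace n × RSpace n →L[ℝ] ℝ :=
  (devMetric g dev q.1).bilinearComp (ContinuousLinearMap.fst ℝ (RSpace n) (RSpace n))
      (ContinuousLinearMap.snd ℝ (RSpace n) (RSpace n))
    - (devMetric g dev q.1).bilinearComp (ContinuousLinearMap.snd ℝ (RSpace n) (RSpace n))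
      (ContinuousLinearMap.fst ℝ (RSpace n) (RSpace n))

/-- The metric `gʳ` in the flat coordinates given by a development map. -/
def devProdMetric (g : Metric n M) (dev : M → RSpace n) (q : M × RSpace n) :
    RSpace n × RSpace n →L[ℝ] RSpace n × RSpace n →L[ℝ] ℝ :=
  (devMetric g dev q.1).bilinearComp (ContinuousLinearMap.fst ℝ (RSpace n) (RSpace n))
      (ContinuousLinearMap.fst ℝ (RSpace n) (RSpace n))
    + (devMetric g dev q.1).bilinearComp (ContinuousLinearMap.snd ℝ (RSpace n) (RSpace n))
      (ContinuousLinearMap.snd ℝ (RSpace n) (RSpace n))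

lemma devForm_apply (g : Metric n M) (q : M × RSpace n) (a b : RSpace n × RSpace n) :
    devForm g dev q a b = devMetric g dev q.1 a.1 b.2 - devMetric g dev q.1 a.2 b.1 := rfl

lemma devProdMetric_apply (g : Metric n M) (q : M × RSpace n) (a b : RSpace n × RSpace n) :
    devProdMetric g dev q a b = devMetric g dev q.1 a.1 b.1 + devMetric g dev q.1 a.2 b.2 := rfl

lemma devForm_swap (g : Metric n M) (q : M × RSpace n) (a b : RSpace n × RSpace n) :
    devForm g dev q a b = - devForm g dev q b a := by
  rw [devForm_apply, devForm_apply, devMetric_symm g q.1 a.1, devMetric_symm g q.1 a.2]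
  ring

namespace IsDevelopingMap

lemma contMDiff_devMetric_fst (hdev : IsDevelopingMap dev) (g : Metric n M) (v w : RSpace n) :
    ContMDiff (prodModel n) 𝓘(ℝ, ℝ) ∞ (fun q : M × RSpace n => devMetric g dev q.1 v w) := by
  have h : ContMDiff 𝓘(ℝ, RSpace n) 𝓘(ℝ, ℝ) ∞ (fun x => devMetric g dev x v w) := fun x =>
    contMDiffAt_inner g (hdev.smoothFieldAt_inverse_ddev v x) (hdev.smoothFieldAt_inverse_ddev w x)
  exact h.comp contMDiff_fst

lemma contMDiff_devForm (hdev : IsDevelopingMap dev) (g : Metric n M) :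
    ContMDiff (prodModel n) 𝓘(ℝ, RSpace n × RSpace n →L[ℝ] RSpace n × RSpace n →L[ℝ] ℝ) ∞
      (devForm g dev) := fun q =>
  contMDiffAt_clm_of_apply fun a => contMDiffAt_clm_of_apply fun b =>
    ((hdev.contMDiff_devMetric_fst g a.1 b.2) q).sub ((hdev.contMDiff_devMetric_fst g a.2 b.1) q)

lemma contMDiff_devProdMetric (hdev : IsDevelopingMap dev) (g : Metric n M) :
    ContMDiff (prodModel n) 𝓘(ℝ, RSpace n × RSpace n →L[ℝ] RSpace n × RSpace n →L[ℝ] ℝ) ∞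
      (devProdMetric g dev) := fun q =>
  contMDiffAt_clm_of_apply fun a => contMDiffAt_clm_of_apply fun b =>
    ((hdev.contMDiff_devMetric_fst g a.1 b.1) q).add ((hdev.contMDiff_devMetric_fst g a.2 b.2) q)

/-- The coefficients of `ω` are pulled back from `M`, so only the horizontal component of `X`
differentiates them. -/
lemma vecDeriv_devForm (hdev : IsDevelopingMap dev) (g : Metric n M) (q : M × RSpace n)
    (X : TangentSpace (prodModel n) q) (a b : RSpace n × RSpace n) :
    vecDeriv (prodModel n) (devForm g dev) q X a b
      = devCubic g dev q.1 (dprod dev q X).1 a.1 b.2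
        - devCubic g dev q.1 (dprod dev q X).1 a.2 b.1 := by
  have h0 : HasMFDerivAt (prodModel n)
      𝓘(ℝ, RSpace n × RSpace n →L[ℝ] RSpace n × RSpace n →L[ℝ] ℝ) (devForm g dev) q
      (vecDeriv (prodModel n) (devForm g dev) q) :=
    ((hdev.contMDiff_devForm g q).mdifferentiableAt (by simp)).hasMFDerivAt
  obtain ⟨D, h1, hD⟩ := hasMFDerivAt_clm_apply_const₂ h0 a b
  obtain ⟨D₁, h2, hD₁⟩ := hdev.exists_hasMFDerivAt_devMetric_apply g q.1 a.1 b.2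
  obtain ⟨D₂, h3, hD₂⟩ := hdev.exists_hasMFDerivAt_devMetric_apply g q.1 a.2 b.1
  have hf : HasMFDerivAt (prodModel n) 𝓘(ℝ, RSpace n) (Prod.fst : M × RSpace n → M) q
      (mfderiv (prodModel n) 𝓘(ℝ, RSpace n) Prod.fst q) := mdifferentiableAt_fst.hasMFDerivAt
  have h4 := hasMFDerivAt_unique h1 ((h2.comp q hf).sub (h3.comp q hf))
  rw [← hD, h4, ← hD₁, ← hD₂, hdev.inverse_ddev_dprod_fst]
  rfl

lemma omegaR_eq_devForm (hdev : IsDevelopingMap dev) (g : Metric n M) (q : M × RSpace n)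
    (X Y : TangentSpace (prodModel n) q) :
    omegaR g dev q X Y = devForm g dev q (dprod dev q X) (dprod dev q Y) :=
  hdev.omegaR_eq g q X Y

/-- Since `dprod` is the differential of a vector valued function, brackets become differences of
derivatives of components, in the shape needed to cancel product rule terms in `dω`. -/
lemma dprod_mlieBracket (hdev : IsDevelopingMap dev)
    {X Y : (q : M × RSpace n) → TangentSpace (prodModel n) q} {q : M × RSpace n}
    (hX : SmoothFieldAt (prodModel n) X q) (hY : SmoothFieldAt (prodModel n) Y q) :
    dprod dev q (VectorField.mlieBracket (prodModel n) X Y q)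
      = vecDeriv (prodModel n) (fun p => dprod dev p (Y p)) q (X q)
        - vecDeriv (prodModel n) (fun p => dprod dev p (X p)) q (Y q) :=
  vecDeriv_mlieBracket hdev.contMDiff_prod hX hY

lemma hasMFDerivAt_dprod (hdev : IsDevelopingMap dev)
    {X : (q : M × RSpace n) → TangentSpace (prodModel n) q} {q : M × RSpace n}
    (hX : SmoothFieldAt (prodModel n) X q) :
    HasMFDerivAt (prodModel n) 𝓘(ℝ, RSpace n × RSpace n) (fun p => dprod dev p (X p)) q
      (vecDeriv (prodModel n) (fun p => dprod dev p (X p)) q) :=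
  ((hX.mfderiv_apply hdev.contMDiff_prod).mdifferentiableAt (by simp)).hasMFDerivAt

/-- The form `ω` is closed. -/
lemma extDerivTwoForm_omegaR (hdev : IsDevelopingMap dev) {g : Metric n M}
    (hg : IsHessianMetric g) {X Y Z : (q : M × RSpace n) → TangentSpace (prodModel n) q}
    {q : M × RSpace n} (hX : SmoothFieldAt (prodModel n) X q)
    (hY : SmoothFieldAt (prodModel n) Y q) (hZ : SmoothFieldAt (prodModel n) Z q) :
    extDerivTwoForm (prodModel n) (omegaR g dev) X Y Z q = 0 := by
  have h0 : HasMFDerivAt (prodModel n)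
      𝓘(ℝ, RSpace n × RSpace n →L[ℝ] RSpace n × RSpace n →L[ℝ] ℝ) (devForm g dev) q
      (vecDeriv (prodModel n) (devForm g dev) q) :=
    ((hdev.contMDiff_devForm g q).mdifferentiableAt (by simp)).hasMFDerivAt
  have key : ∀ {Y Z : (q : M × RSpace n) → TangentSpace (prodModel n) q},
      SmoothFieldAt (prodModel n) Y q → SmoothFieldAt (prodModel n) Z q →
      ∀ v : TangentSpace (prodModel n) q,
      dirDeriv (prodModel n) (fun p => omegaR g dev p (Y p) (Z p)) q v
        = vecDeriv (prodModel n) (devForm g dev) q v (dprod dev q (Y q)) (dprod dev q (Z q))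
          + devForm g dev q (vecDeriv (prodModel n) (fun p => dprod dev p (Y p)) q v)
            (dprod dev q (Z q))
          + devForm g dev q (dprod dev q (Y q))
            (vecDeriv (prodModel n) (fun p => dprod dev p (Z p)) q v) := by
    intro Y Z hY hZ v
    obtain ⟨D, hD, hD'⟩ := hasMFDerivAt_clm_apply₂ h0 (hdev.hasMFDerivAt_dprod hY)
      (hdev.hasMFDerivAt_dprod hZ)
    have h1 : (fun p => omegaR g dev p (Y p) (Z p))
        = fun p => devForm g dev p (dprod dev p (Y p)) (dprod dev p (Z p)) :=
      funext fun p => hdev.omegaR_eq_devForm g p _ _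
    rw [← hD', dirDeriv, h1, hD.mfderiv]
    rfl
  rw [extDerivTwoForm, key hY hZ, key hZ hX, key hX hY]
  simp only [hdev.omegaR_eq_devForm, hdev.dprod_mlieBracket hX hY, hdev.dprod_mlieBracket hY hZ,
    hdev.dprod_mlieBracket hZ hX, map_sub, sub_apply, hdev.vecDeriv_devForm]
  set a := dprod dev q (X q)
  set b := dprod dev q (Y q)
  set c := dprod dev q (Z q)
  -- Antisymmetry matches the bracket terms with the derivatives of the components. The derivatives
  -- of the coefficients remain, six cubic terms that cancel in pairs by total symmetry.
  rw [devForm_swap g q b, devForm_swap g q c, devForm_swap g q a]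
  rw [hdev.devCubic_swap_left hg q.1 b.1 c.1 a.2, hdev.devCubic_swap_left hg q.1 c.1 a.1 b.2,
    hdev.devCubic_swap_left hg q.1 a.1 b.1 c.2, hdev.devCubic_swap_right g q.1 b.1 c.2 a.1,
    hdev.devCubic_swap_right g q.1 c.1 a.2 b.1, hdev.devCubic_swap_right g q.1 a.1 b.2 c.1]
  rw [hdev.devCubic_swap_left hg q.1 b.1 a.1 c.2, hdev.devCubic_swap_left hg q.1 c.1 b.1 a.2,
    hdev.devCubic_swap_left hg q.1 a.1 c.1 b.2]
  ring

end IsDevelopingMap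

/-- The complex coordinates `x + iy` on `ℝⁿ × ℝⁿ`. -/
def complexCoordinates (n : ℕ) : (RSpace n × RSpace n) ≃L[ℝ] (Fin n → ℂ) :=
  LinearEquiv.toContinuousLinearEquiv
    { toFun := fun p i => ⟨p.1 i, p.2 i⟩
      invFun := fun z => (WithLp.toLp 2 fun i => (z i).re, WithLp.toLp 2 fun i => (z i).im)
      map_add' := fun p q => by ext i; apply Complex.ext <;> simp
      map_smul' := fun c p => by ext i; apply Complex.ext <;> simp
      left_inv := fun p => rfl
      right_inv := fun z => rfl }

lemma complexCoordinates_rotate (p : RSpace n × RSpace n) :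
    complexCoordinates n (-p.2, p.1) = Complex.I • complexCoordinates n p := by
  ext i
  apply Complex.ext <;> simp [complexCoordinates]

namespace IsDevelopingMap

/-- The coordinates are `dev x + iv`: `dprod` turns `I` into the rotation, which is multiplication
by `i` in `ℂⁿ`. -/
lemma isComplexStructure (hdev : IsDevelopingMap dev) :
    IsComplexStructure (prodModel n) n (complexI dev) := by
  refine ⟨fun q v => hdev.dprod_injective q ?_, fun q => ?_⟩
  · rw [hdev.dprod_complexI, hdev.dprod_complexI, map_neg]
    rfl
  obtain ⟨D, hq, hD, hDs, A, hA, hA'⟩ := hdev.exists_chart q.1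
  let z : OpenPartialHomeomorph (M × RSpace n) (Fin n → ℂ) :=
    (D.prod (OpenPartialHomeomorph.refl (RSpace n))).trans
      (complexCoordinates n).toHomeomorph.toOpenPartialHomeomorph
  have hz : z.source = D.source ×ˢ Set.univ := by simp [z]
  have hz' : ∀ p ∈ z.source, z p = complexCoordinates n (dev p.1, p.2) := by
    intro p hp
    rw [hz] at hp
    rw [hD hp.1]
    rfl
  have hc : ContMDiff 𝓘(ℝ, RSpace n × RSpace n) 𝓘(ℝ, Fin n → ℂ) ∞ (complexCoordinates n) :=
    (complexCoordinates n).contDiff.contMDiff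
  refine ⟨z, by rw [hz]; exact ⟨hq, trivial⟩, ?_, ?_, ?_⟩
  · exact (hc.comp hdev.contMDiff_prod).contMDiffOn.congr hz'
  · have h1 : ∀ w ∈ z.target, ((complexCoordinates n).symm w).1 ∈ D.target := by
      intro w hw
      have : w ∈ (complexCoordinates n).symm ⁻¹' (D.target ×ˢ Set.univ) := by simpa [z] using hw
      exact this.1
    have h2 : ∀ u ∈ D.target, A.symm u ∈ (chartAt (RSpace n) q.1).target := by
      intro u hu
      have h3 := hA _ (D.map_target hu)
      rw [hD (D.map_target hu), D.right_inv hu] at h3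
      rw [h3, A.symm_apply_apply]
      exact (chartAt (RSpace n) q.1).map_source (hDs (D.map_target hu))
    have hc' : ContMDiff 𝓘(ℝ, Fin n → ℂ) 𝓘(ℝ, RSpace n × RSpace n) ∞ (complexCoordinates n).symm :=
      (complexCoordinates n).symm.contDiff.contMDiff
    have h3 : ContMDiffOn 𝓘(ℝ, RSpace n) 𝓘(ℝ, RSpace n) ∞ D.symm D.target := by
      refine ContMDiffOn.congr ?_ hA'
      exact (contMDiffOn_chart_symm (x := q.1)).comp
        (contDiff_affineMap A.symm.toAffineMap).contMDiff.contMDiffOn h2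
    have h4 : ContMDiffOn 𝓘(ℝ, Fin n → ℂ) 𝓘(ℝ, RSpace n) ∞
        (fun w => D.symm ((complexCoordinates n).symm w).1) z.target :=
      h3.comp ((contDiff_fst.contMDiff).comp hc').contMDiffOn h1
    exact h4.prodMk ((contDiff_snd.contMDiff).comp hc').contMDiffOn
  · intro y hy v
    have h1 : z =ᶠ[𝓝 y] complexCoordinates n ∘ fun q : M × RSpace n => (dev q.1, q.2) := by
      filter_upwards [z.open_source.mem_nhds hy] with p hp using hz' p hp
    have h2 := (((complexCoordinates n).hasFDerivAt.hasMFDerivAt.comp y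
      (hdev.hasMFDerivAt_prod y)).congr_of_eventuallyEq h1).mfderiv
    have h3 : ∀ v, complexDiff (prodModel n) z y v = complexCoordinates n (dprod dev y v) :=
      fun v => congrArg (fun L : TangentSpace (prodModel n) y →L[ℝ] (Fin n → ℂ) => L v) h2
    rw [h3, h3, hdev.dprod_complexI, complexCoordinates_rotate]

lemma devMetric_pos (hdev : IsDevelopingMap dev) (g : Metric n M) (x : M) {v : RSpace n}
    (hv : v ≠ 0) : 0 < devMetric g dev x v v := by
  refine g.pos x _ fun h => hv ?_
  exact (hdev.ddev_inverse x v).symm.trans ((congrArg (ddev dev x) h).trans (map_zero _))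

lemma devMetric_nonneg (hdev : IsDevelopingMap dev) (g : Metric n M) (x : M) (v : RSpace n) :
    0 ≤ devMetric g dev x v v := by
  by_cases hv : v = 0
  · simp [hv]
  · exact (hdev.devMetric_pos g x hv).le

lemma isBounded_devMetric (hdev : IsDevelopingMap dev) (g : Metric n M) (x : M) :
    Bornology.IsBounded {v : RSpace n | devMetric g dev x v v < 1} := by
  refine (NormedSpace.isVonNBounded_iff ℝ).1 (((g.isVonNBounded x).image (ddev dev x)).subset ?_)
  intro v hv
  exact ⟨(ddev dev x).inverse v, hv, hdev.ddev_inverse x v⟩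

end IsDevelopingMap

/-- The metric `gʳ` on `M × ℝⁿ`, as a bilinear map. -/
def metricRForm (g : Metric n M) (dev : M → RSpace n) (q : M × RSpace n) :
    TangentSpace (prodModel n) q →L[ℝ] TangentSpace (prodModel n) q →L[ℝ] ℝ :=
  ContinuousLinearMap.bilinearComp (E' := RSpace n × RSpace n) (F' := RSpace n × RSpace n)
    (devProdMetric g dev q) (dprod dev q) (dprod dev q)

lemma metricRForm_eq (g : Metric n M) (q : M × RSpace n) (v w : TangentSpace (prodModel n) q) :
    metricRForm g dev q v w = devProdMetric g dev q (dprod dev q v) (dprod dev q w) := rfl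

namespace IsDevelopingMap

lemma metricRForm_apply (hdev : IsDevelopingMap dev) (g : Metric n M) (q : M × RSpace n)
    (v w : TangentSpace (prodModel n) q) : metricRForm g dev q v w = metricR g dev q v w :=
  (hdev.metricR_eq g q v w).symm

lemma contMDiff_metricRForm (hdev : IsDevelopingMap dev) (g : Metric n M) :
    ContMDiff (prodModel n)
      ((prodModel n).prod 𝓘(ℝ, RSpace n × RSpace n →L[ℝ] RSpace n × RSpace n →L[ℝ] ℝ)) ∞
      (fun q => TotalSpace.mk' (RSpace n × RSpace n →L[ℝ] RSpace n × RSpace n →L[ℝ] ℝ)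
        (E := fun q : M × RSpace n =>
          TangentSpace (prodModel n) q →L[ℝ] TangentSpace (prodModel n) q →L[ℝ] ℝ) q
        (metricRForm g dev q)) := by
  intro q
  refine contMDiffAt_bilinear_of_frame fun v w => ?_
  have h1 := (smoothFieldAt_trivializationAt_symm (J := prodModel n) q v).mfderiv_apply
    hdev.contMDiff_prod
  have h2 := (smoothFieldAt_trivializationAt_symm (J := prodModel n) q w).mfderiv_apply
    hdev.contMDiff_prod
  exact ((hdev.contMDiff_devProdMetric g q).clm_apply h1).clm_apply h2

lemma metricRForm_symm (g : Metric n M) (q : M × RSpace n)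
    (v w : TangentSpace (prodModel n) q) :
    metricRForm g dev q v w = metricRForm g dev q w v := by
  rw [metricRForm_eq, metricRForm_eq, devProdMetric_apply, devProdMetric_apply,
    devMetric_symm g q.1 (dprod dev q v).1, devMetric_symm g q.1 (dprod dev q v).2]

lemma metricRForm_pos (hdev : IsDevelopingMap dev) (g : Metric n M) (q : M × RSpace n)
    (v : TangentSpace (prodModel n) q) (hv : v ≠ 0) : 0 < metricRForm g dev q v v := by
  rw [metricRForm_eq, devProdMetric_apply]
  have h1 : dprod dev q v ≠ 0 := fun h => hv (hdev.dprod_injective q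
    (h.trans (map_zero (dprod dev q)).symm))
  by_cases h2 : (dprod dev q v).1 = 0
  · have h3 : (dprod dev q v).2 ≠ 0 := fun h3 => h1 (Prod.ext h2 h3)
    exact add_pos_of_nonneg_of_pos (hdev.devMetric_nonneg g _ _) (hdev.devMetric_pos g _ h3)
  · exact add_pos_of_pos_of_nonneg (hdev.devMetric_pos g _ h2) (hdev.devMetric_nonneg g _ _)

/-- Both summands of `gʳ` are nonnegative, so its unit ball lies in a product of two unit balls of
`g`. -/
lemma isVonNBounded_metricRForm (hdev : IsDevelopingMap dev) (g : Metric n M)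
    (q : M × RSpace n) :
    Bornology.IsVonNBounded ℝ {v : TangentSpace (prodModel n) q | metricRForm g dev q v v < 1} := by
  have h1 := (NormedSpace.isVonNBounded_iff ℝ).2
    ((hdev.isBounded_devMetric g q.1).prod (hdev.isBounded_devMetric g q.1))
  refine (h1.image (dprod dev q).inverse).subset fun v hv => ?_
  refine ⟨dprod dev q v, ?_, (hdev.dprod_isInvertible q).inverse_apply_self v⟩
  rw [Set.mem_ofPred_eq, metricRForm_eq, devProdMetric_apply] at hv
  have h2 := hdev.devMetric_nonneg g q.1 (dprod dev q v).1
  have h3 := hdev.devMetric_nonneg g q.1 (dprod dev q v).2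
  exact ⟨by rw [Set.mem_ofPred_eq]; linarith, by rw [Set.mem_ofPred_eq]; linarith⟩

/-- The Riemannian metric `gʳ` on `M × ℝⁿ`. -/
def riemannianMetricR (hdev : IsDevelopingMap dev) (g : Metric n M) :
    ContMDiffRiemannianMetric (prodModel n) ∞ (RSpace n × RSpace n)
      (fun q : M × RSpace n => TangentSpace (prodModel n) q) where
  inner := metricRForm g dev
  symm := metricRForm_symm g
  pos := hdev.metricRForm_pos g
  isVonNBounded := hdev.isVonNBounded_metricRForm g
  contMDiff := hdev.contMDiff_metricRForm g

/-- `(I, ω)` is a Kähler structure on `M × ℝⁿ`. -/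
theorem isKahlerStructure (hdev : IsDevelopingMap dev) {g : Metric n M}
    (hg : IsHessianMetric g) :
    IsKahlerStructure (prodModel n) n (complexI dev) (omegaR g dev) where
  complex := hdev.isComplexStructure
  metric := by
    refine ⟨hdev.riemannianMetricR g, fun q v w => ?_, fun q v w => ?_⟩
    · change metricRForm g dev q _ _ = metricRForm g dev q _ _
      rw [metricRForm_eq, metricRForm_eq, hdev.dprod_complexI, hdev.dprod_complexI,
        devProdMetric_apply, devProdMetric_apply]
      simp [add_comm]
    · exact (hdev.metricRForm_apply g q _ _).symm
  closed X Y Z q hX hY hZ := hdev.extDerivTwoForm_omegaR hg hX hY hZ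

/-- `(I, ω_{c.K.})` is a conformally Kähler structure on `M × ℝⁿ`. -/
theorem isConformallyKahlerStructure (hdev : IsDevelopingMap dev) {g : Metric n M}
    (hg : IsHessianMetric g) {ξ : (x : M) → TangentSpace 𝓘(ℝ, RSpace n) x}
    (hξs : ∀ x, SmoothFieldAt 𝓘(ℝ, RSpace n) ξ x) (hξ : ∀ x, ξ x ≠ 0) :
    IsConformallyKahlerStructure (prodModel n) n (complexI dev) (omegaCK g ξ dev) := by
  have hpos : ∀ x, 0 < g.inner x (ξ x) (ξ x) := fun x => g.pos x _ (hξ x)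
  refine ⟨fun q => (g.inner q.1 (ξ q.1) (ξ q.1))⁻¹, omegaR g dev, fun q => ?_,
    fun q => inv_pos.2 (hpos q.1), hdev.isKahlerStructure hg, fun q v w => rfl⟩
  exact ((contMDiffAt_inner g (hξs q.1) (hξs q.1)).comp q contMDiffAt_fst).inv₀ (hpos q.1).ne'

end IsDevelopingMap

end Kahler

/-! ### Invariance -/

section Invariance

variable {n : ℕ} {M : Type*} [TopologicalSpace M] [ChartedSpace (RSpace n) M]
  [FlatAffineManifold n M] {dev : M → RSpace n}

lemma IsAffineMapAt.contMDiffAt {f : M → M} {x : M} (hf : IsAffineMapAt n f x) :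
    ContMDiffAt 𝓘(ℝ, RSpace n) 𝓘(ℝ, RSpace n) ∞ f x := by
  obtain ⟨hc, A, hA⟩ := hf
  refine contMDiffAt_iff_target.2 ⟨hc, ?_⟩
  have h1 := (contDiff_affineMap A).contMDiff.contMDiffAt.comp x
    (contMDiffAt_of_mem_maximalAtlas (n := ∞)
      (IsManifold.chart_mem_maximalAtlas (I := 𝓘(ℝ, RSpace n)) x) (mem_chart_source _ x))
  refine h1.congr_of_eventuallyEq ?_
  filter_upwards [hA] with y hy
  simpa using hy

namespace IsDevelopingMap

variable {K : Type*} [Group K] {φ : K →* Equiv.Perm M} {θ : K →* (RSpace n ≃ᵃ[ℝ] RSpace n)}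

lemma contMDiff_psi (haff : ∀ k x, IsAffineMapAt n (φ k) x) (s : AffineSemidirect θ) :
    ContMDiff (prodModel n) (prodModel n) ∞ (psi φ θ s) := by
  have h1 : ContMDiff 𝓘(ℝ, RSpace n) 𝓘(ℝ, RSpace n) ∞ (φ s.right) := fun x =>
    (haff s.right x).contMDiffAt
  have h2 : ContMDiff 𝓘(ℝ, RSpace n) 𝓘(ℝ, RSpace n) ∞
      (fun v => θ s.right v + Multiplicative.toAdd s.left) :=
    ((contDiff_affineMap (θ s.right).toAffineMap).add contDiff_const).contMDiff
  exact (h1.comp contMDiff_fst).prodMk (h2.comp contMDiff_snd)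

/-- The map acts by `θ` on both developed factors; differentiation removes the translation and
leaves the linear part twice. -/
lemma dprod_mfderiv_psi (hdev : IsDevelopingMap dev) (haff : ∀ k x, IsAffineMapAt n (φ k) x)
    (heq : ∀ k x, dev (φ k x) = θ k (dev x)) (s : AffineSemidirect θ) (q : M × RSpace n)
    (X : TangentSpace (prodModel n) q) :
    dprod dev (psi φ θ s q) (mfderiv (prodModel n) (prodModel n) (psi φ θ s) q X)
      = ((θ s.right).linear (dprod dev q X).1, (θ s.right).linear (dprod dev q X).2) := by
  have h1 := (hdev.hasMFDerivAt_prod (psi φ θ s q)).comp q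
    ((contMDiff_psi haff s q).mdifferentiableAt (by simp)).hasMFDerivAt
  have hA := hasFDerivAt_affineMap (θ s.right).toAffineMap
  have h2 := ((hA (dev q.1)).prodMap (dev q.1, q.2)
    ((hA q.2).add_const (Multiplicative.toAdd s.left))).hasMFDerivAt.comp q
      (hdev.hasMFDerivAt_prod q)
  have h3 : (fun q : M × RSpace n => (dev q.1, q.2)) ∘ psi φ θ s
      = Prod.map (fun y => (θ s.right).toAffineMap y)
          (fun y => (θ s.right).toAffineMap y + Multiplicative.toAdd s.left) ∘
        fun q : M × RSpace n => (dev q.1, q.2) :=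
    funext fun q => Prod.ext (heq _ _) rfl
  rw [h3] at h1
  exact congrArg (fun L : TangentSpace (prodModel n) q →L[ℝ] RSpace n × RSpace n => L X)
    (hasMFDerivAt_unique h1 h2)

lemma devMetric_map (hdev : IsDevelopingMap dev) {g : Metric n M} {f : M → M}
    {A : RSpace n ≃ᵃ[ℝ] RSpace n} (h : ∀ x, dev (f x) = A (dev x)) {x : M}
    (hf : IsAffineMapAt n f x) {c : ℝ}
    (hc : ∀ v w : TangentSpace 𝓘(ℝ, RSpace n) x,
      g.inner (f x) (mfderiv 𝓘(ℝ, RSpace n) 𝓘(ℝ, RSpace n) f x v)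
        (mfderiv 𝓘(ℝ, RSpace n) 𝓘(ℝ, RSpace n) f x w) = c * g.inner x v w) (v w : RSpace n) :
    devMetric g dev (f x) (A.linear v) (A.linear w) = c * devMetric g dev x v w := by
  have h1 := hc ((ddev dev x).inverse v) ((ddev dev x).inverse w)
  rw [hdev.inner_eq_devMetric, hdev.ddev_map h hf.mdifferentiableAt,
    hdev.ddev_map h hf.mdifferentiableAt, hdev.ddev_inverse, hdev.ddev_inverse] at h1
  exact h1

/-- The conformally Kähler structure is invariant under affine maps which preserve the field and
multiply the metric by a constant. -/
theorem isInvariantStructure (hdev : IsDevelopingMap dev) {g : Metric n M}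
    {ξ : (x : M) → TangentSpace 𝓘(ℝ, RSpace n) x} (haff : ∀ k x, IsAffineMapAt n (φ k) x)
    (heq : ∀ k x, dev (φ k x) = θ k (dev x)) {c : K → ℝ} (hc : ∀ k, c k ≠ 0)
    (hg : ∀ k x (v w : TangentSpace 𝓘(ℝ, RSpace n) x),
      g.inner (φ k x) (mfderiv 𝓘(ℝ, RSpace n) 𝓘(ℝ, RSpace n) (φ k) x v)
        (mfderiv 𝓘(ℝ, RSpace n) 𝓘(ℝ, RSpace n) (φ k) x w) = c k * g.inner x v w)
    (hξ : ∀ k x, mfderiv 𝓘(ℝ, RSpace n) 𝓘(ℝ, RSpace n) (φ k) x (ξ x) = ξ (φ k x)) :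
    IsInvariantStructure (prodModel n) (psi φ θ) (complexI dev) (omegaCK g ξ dev) := by
  intro s
  refine ⟨contMDiff_psi haff s, fun q X => ?_, fun q X Y => ?_⟩
  · apply hdev.dprod_injective
    rw [hdev.dprod_complexI, hdev.dprod_mfderiv_psi haff heq, hdev.dprod_mfderiv_psi haff heq,
      hdev.dprod_complexI]
    simp
  · have hq : (psi φ θ s q).1 = φ s.right q.1 := rfl
    -- Since `ξ` is preserved, `g(ξ, ξ)` acquires the same factor `c` as `ω`, and the two cancel.
    have h1 := hg s.right q.1 (ξ q.1) (ξ q.1)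
    rw [hξ] at h1
    have h2 := hdev.devMetric_map (heq s.right) (haff s.right q.1) (hg s.right q.1)
    rw [omegaCK, omegaCK, hdev.omegaR_eq, hdev.omegaR_eq, hdev.dprod_mfderiv_psi haff heq,
      hdev.dprod_mfderiv_psi haff heq, hq, h1, h2, h2, mul_inv, ← mul_sub]
    have := hc s.right
    field_simp

end IsDevelopingMap

end Invariance

/-! ### The flow of the field -/

lemma hasDerivAt_of_hasMFDerivAt {F : Type*} [NormedAddCommGroup F] [NormedSpace ℝ F]
    {f : ℝ → F} {t : ℝ} {L : ℝ →L[ℝ] F} (h : HasMFDerivAt 𝓘(ℝ, ℝ) 𝓘(ℝ, F) f t L) :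
    HasDerivAt f (L 1) t := by
  have h' : HasFDerivAt f L t := hasMFDerivAt_iff_hasFDerivAt.1 h
  exact h'.hasDerivAt

section Flow

variable {n : ℕ} {M : Type*} [TopologicalSpace M] [ChartedSpace (RSpace n) M]
  {ξ : (x : M) → TangentSpace 𝓘(ℝ, RSpace n) x}

/-- Global uniqueness, which relies on `M` being Hausdorff. The flow law and the commutation with
`G` both follow by comparing two curves at time `0`. -/
lemma isMIntegralCurve_eq [FlatAffineManifold n M] [T2Space M]
    (hξs : ∀ x, SmoothFieldAt 𝓘(ℝ, RSpace n) ξ x)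
    {γ γ' : ℝ → M} (hγ : IsMIntegralCurve γ ξ) (hγ' : IsMIntegralCurve γ' ξ) (h : γ 0 = γ' 0) :
    γ = γ' := by
  have h1 : IsManifold 𝓘(ℝ, RSpace n) 1 M := IsManifold.of_le (n := ∞) (by simp)
  have hv : ContMDiff 𝓘(ℝ, RSpace n) 𝓘(ℝ, RSpace n).tangent 1
      (fun x => (⟨x, ξ x⟩ : TangentBundle 𝓘(ℝ, RSpace n) M)) := fun x => (hξs x).of_le (by simp)
  exact isMIntegralCurve_Ioo_eq_of_contMDiff_boundaryless hv hγ hγ' h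

/-- The image of an integral curve under a map preserving the field. -/
lemma isMIntegralCurve_comp {γ : ℝ → M} (hγ : IsMIntegralCurve γ ξ) {f : M → M}
    (hf : ∀ x, MDifferentiableAt 𝓘(ℝ, RSpace n) 𝓘(ℝ, RSpace n) f x)
    (hfξ : ∀ x, mfderiv 𝓘(ℝ, RSpace n) 𝓘(ℝ, RSpace n) f x (ξ x) = ξ (f x)) :
    IsMIntegralCurve (f ∘ γ) ξ := by
  intro t
  have h := (hf (γ t)).hasMFDerivAt.comp t (hγ t)
  refine HasMFDerivAt.congr_mfderiv h (ContinuousLinearMap.ext fun s : ℝ => Eq.symm ?_)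
  change s • ξ (f (γ t)) = mfderiv 𝓘(ℝ, RSpace n) 𝓘(ℝ, RSpace n) f (γ t) (s • ξ (γ t))
  exact (congrArg (fun u : TangentSpace 𝓘(ℝ, RSpace n) (f (γ t)) => s • u) (hfξ (γ t)).symm).trans
    ((mfderiv 𝓘(ℝ, RSpace n) 𝓘(ℝ, RSpace n) f (γ t)).map_smul s (ξ (γ t))).symm

/-- The flow of a complete field. -/
lemma exists_flow [FlatAffineManifold n M] [T2Space M]
    (hξs : ∀ x, SmoothFieldAt 𝓘(ℝ, RSpace n) ξ x)
    (hc : IsCompleteField ξ) : ∃ ρ : Multiplicative ℝ →* Equiv.Perm M,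
      ∀ x, IsMIntegralCurve (fun t : ℝ => ρ (Multiplicative.ofAdd t) x) ξ := by
  choose γ h0 hγ using hc
  have hadd : ∀ x s t, γ x (s + t) = γ (γ x t) s := by
    intro x s t
    exact congrFun (isMIntegralCurve_eq hξs ((hγ x).comp_add t) (hγ (γ x t))
      (by simp [h0])) s
  have hinv : ∀ x t, γ (γ x t) (-t) = x := fun x t => by rw [← hadd, neg_add_cancel, h0]
  refine ⟨MonoidHom.mk' (fun t => ⟨fun x => γ x t.toAdd, fun x => γ x (-t.toAdd),
    fun x => hinv x _, fun x => by simpa using hinv x (-t.toAdd)⟩) fun s t => ?_, hγ⟩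
  exact Equiv.ext fun x => hadd x _ _

variable {ρ : Multiplicative ℝ →* Equiv.Perm M}

/-- The flow of a complete affine field acts by affine maps. -/
lemma IsAffineField.isAffineMapAt_flow (hξ : IsAffineField ξ)
    (hρ : ∀ x, IsMIntegralCurve (fun t : ℝ => ρ (Multiplicative.ofAdd t) x) ξ)
    (r : Multiplicative ℝ) (x : M) : IsAffineMapAt n (ρ r) x := by
  -- The global flow is a local flow on all of `M`; the bound `|r| + 1` only ensures that the time
  -- `r` is in the open interval.
  have h := hξ Set.univ (|r.toAdd| + 1) (fun t x => ρ (Multiplicative.ofAdd t) x) isOpen_univ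
    (by positivity) (fun x _ => ⟨by simp, (hρ x).isMIntegralCurveOn _⟩) r.toAdd
    ⟨by linarith [neg_abs_le r.toAdd], by linarith [le_abs_self r.toAdd]⟩ x (Set.mem_univ x)
  exact h

/-- A map which takes an integral curve to an integral curve preserves the field along it. -/
lemma mfderiv_field_of_isMIntegralCurve {γ : ℝ → M} {f : M → M} (hγ : IsMIntegralCurve γ ξ)
    (hfγ : IsMIntegralCurve (f ∘ γ) ξ) {t : ℝ}
    (hf : MDifferentiableAt 𝓘(ℝ, RSpace n) 𝓘(ℝ, RSpace n) f (γ t)) :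
    mfderiv 𝓘(ℝ, RSpace n) 𝓘(ℝ, RSpace n) f (γ t) (ξ (γ t)) = ξ (f (γ t)) := by
  have h := congrArg (fun L : ℝ →L[ℝ] RSpace n => L 1)
    (hasMFDerivAt_unique (hf.hasMFDerivAt.comp t (hγ t)) (hfγ t))
  refine Eq.trans ?_ (h.trans (one_smul ℝ (ξ (f (γ t)))))
  exact congrArg (mfderiv 𝓘(ℝ, RSpace n) 𝓘(ℝ, RSpace n) f (γ t)) (one_smul ℝ (ξ (γ t))).symm

/-- The flow of a field preserves the field. -/
lemma mfderiv_flow_field (hρ : ∀ x, IsMIntegralCurve (fun t : ℝ => ρ (Multiplicative.ofAdd t) x) ξ)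
    {r : Multiplicative ℝ} {x : M}
    (hr : MDifferentiableAt 𝓘(ℝ, RSpace n) 𝓘(ℝ, RSpace n) (ρ r) x) :
    mfderiv 𝓘(ℝ, RSpace n) 𝓘(ℝ, RSpace n) (ρ r) x (ξ x) = ξ (ρ r x) := by
  have h0 : ρ (Multiplicative.ofAdd 0) x = x := by simp
  -- As `ℝ` is commutative, `ρ r` carries the flow line of `x` to that of `ρ r x`.
  have h1 : ρ r ∘ (fun t : ℝ => ρ (Multiplicative.ofAdd t) x)
      = fun t : ℝ => ρ (Multiplicative.ofAdd t) (ρ r x) := by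
    funext t
    change (ρ r * ρ (Multiplicative.ofAdd t)) x = (ρ (Multiplicative.ofAdd t) * ρ r) x
    rw [← map_mul, ← map_mul, mul_comm]
  have h2 : mfderiv 𝓘(ℝ, RSpace n) 𝓘(ℝ, RSpace n) (ρ r) (ρ (Multiplicative.ofAdd 0) x)
      (ξ (ρ (Multiplicative.ofAdd 0) x)) = ξ (ρ r (ρ (Multiplicative.ofAdd 0) x)) :=
    mfderiv_field_of_isMIntegralCurve (t := 0) (hρ x) (by rw [h1]; exact hρ (ρ r x))
      (by rwa [← h0] at hr)
  rwa [h0] at h2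

/-- Maps preserving a field commute with its flow. -/
lemma flow_comm [FlatAffineManifold n M] [T2Space M]
    (hξs : ∀ x, SmoothFieldAt 𝓘(ℝ, RSpace n) ξ x)
    (hρ : ∀ x, IsMIntegralCurve (fun t : ℝ => ρ (Multiplicative.ofAdd t) x) ξ) {f : M → M}
    (hf : ∀ x, MDifferentiableAt 𝓘(ℝ, RSpace n) 𝓘(ℝ, RSpace n) f x)
    (hfξ : ∀ x, mfderiv 𝓘(ℝ, RSpace n) 𝓘(ℝ, RSpace n) f x (ξ x) = ξ (f x))
    (r : Multiplicative ℝ) (x : M) : f (ρ r x) = ρ r (f x) :=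
  congrFun (isMIntegralCurve_eq hξs (isMIntegralCurve_comp (hρ x) hf hfξ) (hρ (f x))
    (by simp)) r.toAdd

namespace IsDevelopingMap

variable {dev : M → RSpace n}

/-- Any vector is, up to scaling, a difference of values of a development map. -/
lemma exists_dev_eq_add_smul (hdev : IsDevelopingMap dev) (x : M) (v : RSpace n) :
    ∃ (c : ℝ) (y : M), c ≠ 0 ∧ dev y = dev x + c • v := by
  obtain ⟨D, hx, hD, -⟩ := hdev.exists_chart x
  have h1 : Filter.Tendsto (fun c : ℝ => dev x + c • v) (𝓝[≠] 0) (𝓝 (dev x)) := by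
    have : Continuous fun c : ℝ => dev x + c • v := by fun_prop
    have h := this.tendsto 0
    rw [zero_smul, add_zero] at h
    exact h.mono_left nhdsWithin_le_nhds
  have h2 : D.target ∈ 𝓝 (dev x) := by
    rw [hD hx]
    exact D.open_target.mem_nhds (D.map_source hx)
  obtain ⟨c, hc, hc0⟩ := ((h1.eventually h2).and eventually_mem_nhdsWithin).exists
  exact ⟨c, D.symm (dev x + c • v), hc0, by
    rw [hD (D.map_target hc), D.right_inv hc]⟩

variable [FlatAffineManifold n M]

lemma hasDerivAt_dev_flow (hdev : IsDevelopingMap dev)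
    (hρ : ∀ x, IsMIntegralCurve (fun t : ℝ => ρ (Multiplicative.ofAdd t) x) ξ) (x : M) :
    HasDerivAt (fun t : ℝ => dev (ρ (Multiplicative.ofAdd t) x)) (ddev dev x (ξ x)) 0 := by
  have h0 : ∀ y, ρ (Multiplicative.ofAdd 0) y = y := fun y => by simp
  have h1 := (hdev.hasMFDerivAt _).comp (0 : ℝ) (hρ x 0)
  have h2 := hasDerivAt_of_hasMFDerivAt h1
  have h3 : ddev dev (ρ (Multiplicative.ofAdd 0) x)
      ((1 : ℝ) • ξ (ρ (Multiplicative.ofAdd 0) x)) = ddev dev x (ξ x) := by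
    rw [h0, one_smul]
  rw [← h3]
  exact h2

/-- The linear parts of the affine flow on `ℝⁿ` induced by the flow of an affine field are
generated by an endomorphism, which is the linear part of the field. -/
lemma exists_generator (hdev : IsDevelopingMap dev) [Nonempty M]
    (hρ : ∀ x, IsMIntegralCurve (fun t : ℝ => ρ (Multiplicative.ofAdd t) x) ξ)
    {θ : Multiplicative ℝ →* (RSpace n ≃ᵃ[ℝ] RSpace n)}
    (hθ : ∀ r x, dev (ρ r x) = θ r (dev x)) :
    ∃ B : RSpace n →L[ℝ] RSpace n,
      (∀ v t, HasDerivAt (fun t : ℝ => (θ (Multiplicative.ofAdd t)).linear v)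
        (B ((θ (Multiplicative.ofAdd t)).linear v)) t) ∧
      ∀ x y, ddev dev y (ξ y) - ddev dev x (ξ x) = B (dev y - dev x) := by
  have hlin : ∀ (t : ℝ) (p q : RSpace n), (θ (Multiplicative.ofAdd t)).linear (p - q)
      = θ (Multiplicative.ofAdd t) p - θ (Multiplicative.ofAdd t) q := fun t p q =>
    (θ (Multiplicative.ofAdd t)).toAffineMap.linearMap_vsub p q
  have h1 : ∀ x y, HasDerivAt (fun t : ℝ => (θ (Multiplicative.ofAdd t)).linear (dev y - dev x))
      (ddev dev y (ξ y) - ddev dev x (ξ x)) 0 := by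
    intro x y
    have h := (hdev.hasDerivAt_dev_flow hρ y).sub (hdev.hasDerivAt_dev_flow hρ x)
    refine h.congr_of_eventuallyEq (Filter.Eventually.of_forall fun t => ?_)
    simp [hlin, hθ]
  -- Nothing is assumed about the regularity of `θ` in `t`; it is inherited from flow lines, because
  -- each `v` is a multiple of some `dev y - dev x`.
  have h2 : ∀ v, DifferentiableAt ℝ (fun t : ℝ => (θ (Multiplicative.ofAdd t)).linear v) 0 := by
    intro v
    obtain ⟨c, y, hc, hy⟩ := hdev.exists_dev_eq_add_smul (Classical.arbitrary M) v
    have h := ((h1 (Classical.arbitrary M) y).const_smul c⁻¹).differentiableAt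
    refine h.congr_of_eventuallyEq (Filter.Eventually.of_forall fun t => ?_)
    simp [hy, hc]
  let B : RSpace n →ₗ[ℝ] RSpace n :=
    { toFun := fun v => deriv (fun t : ℝ => (θ (Multiplicative.ofAdd t)).linear v) 0
      map_add' := fun v w => by
        simp only [map_add]
        exact deriv_fun_add (h2 v) (h2 w)
      map_smul' := fun c v => by
        simp only [map_smul]
        exact deriv_fun_const_smul c (h2 v) }
  refine ⟨B.toContinuousLinearMap, fun v t => ?_, fun x y => (h1 x y).deriv.symm⟩
  -- The one-parameter group law moves the derivative from time `0` to time `t`.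
  have h3 : HasDerivAt (fun s : ℝ => (θ (Multiplicative.ofAdd s)).linear
      ((θ (Multiplicative.ofAdd t)).linear v)) (B ((θ (Multiplicative.ofAdd t)).linear v))
      (t - t) := by
    rw [sub_self]
    exact (h2 _).hasDerivAt
  refine (h3.comp_sub_const t t).congr_of_eventuallyEq (Filter.Eventually.of_forall fun s => ?_)
  change _ = (θ (Multiplicative.ofAdd (s - t)) * θ (Multiplicative.ofAdd t)).linear v
  rw [← map_mul, ← ofAdd_add, sub_add_cancel]

variable {g : Metric n M}

/-- The equation `L_ξ g = 2 g` in the flat coordinates given by a development map. -/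
lemma devCubic_field (hdev : IsDevelopingMap dev) (hM : IsSelfsimilarHessian g ξ)
    {B : RSpace n →L[ℝ] RSpace n}
    (hB : ∀ x y, ddev dev y (ξ y) - ddev dev x (ξ x) = B (dev y - dev x)) (x : M)
    (a b : RSpace n) :
    devCubic g dev x (ddev dev x (ξ x)) a b + devMetric g dev x (B a) b
      + devMetric g dev x a (B b) = 2 * devMetric g dev x a b := by
  have hY : ∀ a, SmoothFieldAt 𝓘(ℝ, RSpace n) (fun y => (ddev dev y).inverse a) x :=
    fun a => hdev.smoothFieldAt_inverse_ddev a x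
  -- Developed, `ξ` is an affine function of `dev` with linear part `B`, so its bracket with the
  -- constant field `a` is `-B a`.
  have hbr : ∀ a, ddev dev x (VectorField.mlieBracket 𝓘(ℝ, RSpace n) ξ
      (fun y => (ddev dev y).inverse a) x) = -B a := by
    intro a
    have h1 := vecDeriv_mlieBracket hdev.contMDiff (hM.smooth x) (hY a)
    have h2 : (fun y => vecDeriv 𝓘(ℝ, RSpace n) dev y ((ddev dev y).inverse a)) = fun _ => a :=
      funext fun y => hdev.ddev_inverse y a
    have h3 : (fun y => vecDeriv 𝓘(ℝ, RSpace n) dev y (ξ y))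
        = fun y => B (dev y - dev x) + ddev dev x (ξ x) :=
      funext fun y => by rw [← hB x y, sub_add_cancel]; rfl
    have h4 : HasMFDerivAt 𝓘(ℝ, RSpace n) 𝓘(ℝ, RSpace n)
        (fun y => B (dev y - dev x) + ddev dev x (ξ x)) x (B ∘L ddev dev x) :=
      HasMFDerivAt.comp (g := fun z : RSpace n => B (z - dev x) + ddev dev x (ξ x)) x
        (((B.hasFDerivAt.comp (dev x) ((hasFDerivAt_id (dev x)).sub_const (dev x))).add_const
          (ddev dev x (ξ x))).hasMFDerivAt) (hdev.hasMFDerivAt x)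
    have h5 : vecDeriv 𝓘(ℝ, RSpace n) (fun _ : M => a) x = 0 := mfderiv_const
    have h6 : vecDeriv 𝓘(ℝ, RSpace n) (fun y => B (dev y - dev x) + ddev dev x (ξ x)) x
        = B ∘L ddev dev x := h4.mfderiv
    rw [h2, h3, h5, h6] at h1
    refine h1.trans ?_
    change (0 : RSpace n) - B (ddev dev x ((ddev dev x).inverse a)) = _
    rw [hdev.ddev_inverse, zero_sub]
  have h := hM.lieDeriv _ _ x (hY a) (hY b)
  obtain ⟨D, h1, hD⟩ := hdev.exists_hasMFDerivAt_devMetric_apply g x a b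
  have h2 : dirDeriv 𝓘(ℝ, RSpace n)
      (fun y => g.inner y ((ddev dev y).inverse a) ((ddev dev y).inverse b)) x (ξ x)
      = devCubic g dev x (ddev dev x (ξ x)) a b := by
    rw [← hD, hdev.inverse_ddev]
    exact congrArg (fun L : TangentSpace 𝓘(ℝ, RSpace n) x →L[ℝ] ℝ => L (ξ x)) h1.mfderiv
  rw [lieDerivForm, h2] at h
  simp only [hdev.inner_eq_devMetric, hbr, hdev.ddev_inverse] at h
  simp only [map_neg, neg_apply] at h
  linarith

/-- The flow of the field multiplies the metric by an exponential. -/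
lemma inner_flow (hdev : IsDevelopingMap dev) [Nonempty M] (hM : IsSelfsimilarHessian g ξ)
    (hρ : ∀ x, IsMIntegralCurve (fun t : ℝ => ρ (Multiplicative.ofAdd t) x) ξ)
    {θ : Multiplicative ℝ →* (RSpace n ≃ᵃ[ℝ] RSpace n)}
    (hθ : ∀ r x, dev (ρ r x) = θ r (dev x)) (r : Multiplicative ℝ) (x : M)
    (v w : TangentSpace 𝓘(ℝ, RSpace n) x) :
    g.inner (ρ r x) (mfderiv 𝓘(ℝ, RSpace n) 𝓘(ℝ, RSpace n) (ρ r) x v)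
        (mfderiv 𝓘(ℝ, RSpace n) 𝓘(ℝ, RSpace n) (ρ r) x w)
      = Real.exp (2 * r.toAdd) * g.inner x v w := by
  obtain ⟨B, hB1, hB2⟩ := hdev.exists_generator hρ hθ
  -- This is `g` evaluated on the two vectors pushed forward by the flow. The product rule yields
  -- exactly the left side of `devCubic_field`, hence `E' = 2E`.
  let E : ℝ → ℝ := fun t => devMetric g dev (ρ (Multiplicative.ofAdd t) x)
    ((θ (Multiplicative.ofAdd t)).linear (ddev dev x v))
    ((θ (Multiplicative.ofAdd t)).linear (ddev dev x w))
  have hE : ∀ t, HasDerivAt E (2 * E t) t := by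
    intro t
    have h1 := (hdev.hasMFDerivAt_devMetric g _).comp t (hρ x t)
    obtain ⟨D, h2, hD⟩ := hasMFDerivAt_clm_apply₂ h1
      (hB1 (ddev dev x v) t).hasFDerivAt.hasMFDerivAt
      (hB1 (ddev dev x w) t).hasFDerivAt.hasMFDerivAt
    have h3 := hasDerivAt_of_hasMFDerivAt h2
    have h4 : D (1 : ℝ) = 2 * E t := by
      rw [← hdev.devCubic_field hM hB2, devCubic, hdev.inverse_ddev]
      refine (hD (1 : ℝ)).trans ?_
      have e1 : ∀ u : RSpace n, (ContinuousLinearMap.toSpanSingleton ℝ u) (1 : ℝ) = u := by simp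
      refine congrArg₂ _ (congrArg₂ _ ?_ ?_) ?_
      · exact congrArg (fun L : RSpace n →L[ℝ] RSpace n →L[ℝ] ℝ => L _ _)
          (congrArg (mfderiv 𝓘(ℝ, RSpace n) 𝓘(ℝ, RSpace n →L[ℝ] RSpace n →L[ℝ] ℝ)
            (devMetric g dev) (ρ (Multiplicative.ofAdd t) x)) (one_smul ℝ _))
      · exact congrArg (fun u => devMetric g dev _ u _) (e1 _)
      · exact congrArg (fun u => devMetric g dev _ _ u) (e1 _)
    rw [← h4]
    exact h3
  -- Integrating factor for `E' = 2E`.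
  have hc : ∀ t, HasDerivAt (fun t => Real.exp (-(2 * t)) * E t) 0 t := by
    intro t
    have h1 := (((hasDerivAt_id t).const_mul 2).fun_neg.exp).mul (hE t)
    exact h1.congr_deriv (by simp only [id]; ring)
  have h0 := is_const_of_deriv_eq_zero (fun t => (hc t).differentiableAt) (fun t => (hc t).deriv)
    r.toAdd 0
  have hE0 : E 0 = g.inner x v w := by
    rw [hdev.inner_eq_devMetric]
    change devMetric g dev (ρ 1 x) ((θ 1).linear _) ((θ 1).linear _) = _
    rw [map_one, map_one]
    rfl
  have hEr : E r.toAdd = g.inner (ρ r x) (mfderiv 𝓘(ℝ, RSpace n) 𝓘(ℝ, RSpace n) (ρ r) x v)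
        (mfderiv 𝓘(ℝ, RSpace n) 𝓘(ℝ, RSpace n) (ρ r) x w) := by
    have hr := (hM.affine.isAffineMapAt_flow hρ r x).mdifferentiableAt
    rw [hdev.inner_eq_devMetric, hdev.ddev_map (hθ r) hr, hdev.ddev_map (hθ r) hr]
    rfl
  rw [← hEr, ← hE0]
  simp only [mul_zero, neg_zero, Real.exp_zero, one_mul] at h0
  rw [← h0, ← mul_assoc, ← Real.exp_add]
  simp

end IsDevelopingMap

end Flow

end SelfsimilarHessian

end

open SelfsimilarHessian

/-! ### Assembly of the theorem -/

theorem theorem4p6 {n : ℕ} {M : Type*} [TopologicalSpace M] [T2Space M]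
    [ChartedSpace (RSpace n) M] [FlatAffineManifold n M] [SimplyConnectedSpace M]
    (g : Metric n M) (ξ : (x : M) → TangentSpace 𝓘(ℝ, RSpace n) x)
    (hM : IsSelfsimilarHessian g ξ) (hξ : ∀ x, ξ x ≠ 0) :
    -- there is a development map, and for each one of them the following holds
    (∃ dev : M → RSpace n, IsDevelopingMap dev) ∧
    ∀ dev : M → RSpace n, IsDevelopingMap dev →
    -- the identification `TM = M × ℝⁿ`
    (∃ τ : Diffeomorph 𝓘(ℝ, RSpace n).tangent (prodModel n)
        (TangentBundle 𝓘(ℝ, RSpace n) M) (M × RSpace n) ∞,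
      (∀ p, τ p = (p.proj, ddev dev p.proj p.snd)) ∧
      (∀ p X, mfderiv 𝓘(ℝ, RSpace n).tangent (prodModel n) τ p (complexTM p X)
        = complexI dev (τ p) (mfderiv 𝓘(ℝ, RSpace n).tangent (prodModel n) τ p X)) ∧
      ∀ p X Y, metricR g dev (τ p) (mfderiv 𝓘(ℝ, RSpace n).tangent (prodModel n) τ p X)
        (mfderiv 𝓘(ℝ, RSpace n).tangent (prodModel n) τ p Y) = metricTM g p X Y) ∧
    -- `(I, ω)` is Kähler
    IsKahlerStructure (prodModel n) n (complexI dev) (omegaR g dev) ∧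
    -- the action `θ` of `G` on `ℝⁿ`, determined by equivariance
    ∃ θ : affineIsometryGroup g ξ →* (RSpace n ≃ᵃ[ℝ] RSpace n),
      (∀ (a : affineIsometryGroup g ξ) (x : M), dev ((a : Equiv.Perm M) x) = θ a (dev x)) ∧
      -- invariance under `G ⋉ ℝⁿ`
      (IsConformallyKahlerStructure (prodModel n) n (complexI dev) (omegaCK g ξ dev) ∧
        IsInvariantStructure (prodModel n) (psi (affineIsometryGroup g ξ).subtype θ)
          (complexI dev) (omegaCK g ξ dev)) ∧
      (IsCompleteField ξ →
        -- the flow `ρ` of `ξ`, the action `Φ` of `ℝ × G` on `M` and the one `Θ` on `ℝⁿ`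
        ∃ (ρ : Multiplicative ℝ →* Equiv.Perm M)
          (Φ : Multiplicative ℝ × affineIsometryGroup g ξ →* Equiv.Perm M)
          (Θ : Multiplicative ℝ × affineIsometryGroup g ξ →* (RSpace n ≃ᵃ[ℝ] RSpace n)),
          (∀ x, IsMIntegralCurve (fun t : ℝ => ρ (Multiplicative.ofAdd t) x) ξ) ∧
          (∀ r (a : affineIsometryGroup g ξ) x, Φ (r, a) x = ρ r ((a : Equiv.Perm M) x)) ∧
          (∀ k x, dev (Φ k x) = Θ k (dev x)) ∧
          -- invariance under `(ℝ × G) ⋉ ℝⁿ`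
          IsInvariantStructure (prodModel n) (psi Φ Θ) (complexI dev) (omegaCK g ξ dev) ∧
          -- homogeneity when `G` is transitive on `{g(ξ, ξ) = 1}`
          ((∀ x y : M, g.inner x (ξ x) (ξ x) = 1 → g.inner y (ξ y) (ξ y) = 1 →
              ∃ a : affineIsometryGroup g ξ, (a : Equiv.Perm M) x = y) →
            IsHomogeneousConformallyKahler (prodModel n) n (psi Φ Θ)
              (complexI dev) (omegaCK g ξ dev))) := by
  have hX : ∀ {f : Equiv.Perm M}, IsAffineIsometry g ξ f →
      ∀ x, MDifferentiableAt 𝓘(ℝ, RSpace n) 𝓘(ℝ, RSpace n) f x :=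
    fun hf x => (hf.affine x).mdifferentiableAt
  refine ⟨exists_isDevelopingMap n M, fun dev hdev => ⟨⟨hdev.tangentDiffeomorph, fun p => rfl,
    hdev.tangentDiffeomorph_complexTM, hdev.tangentDiffeomorph_metricTM g⟩,
    hdev.isKahlerStructure hM.hessian, ?_⟩⟩
  have hck := hdev.isConformallyKahlerStructure hM.hessian hM.smooth hξ
  have hG : ∀ (a : affineIsometryGroup g ξ) x,
      IsAffineMapAt n ((affineIsometryGroup g ξ).subtype a) x := fun a => a.2.affine
  obtain ⟨θ, hθ⟩ := hdev.exists_affineAction (affineIsometryGroup g ξ).subtype hG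
  refine ⟨θ, hθ, ⟨hck, hdev.isInvariantStructure hG hθ (c := fun _ => 1) (fun _ => one_ne_zero)
    (fun a x v w => (a.2.isometry x v w).trans (one_mul _).symm) (fun a => a.2.field)⟩,
    fun hc => ?_⟩
  obtain ⟨ρ, hρ⟩ := exists_flow hM.smooth hc
  have hρaff := hM.affine.isAffineMapAt_flow hρ
  have hρξ : ∀ r x, mfderiv 𝓘(ℝ, RSpace n) 𝓘(ℝ, RSpace n) (ρ r) x (ξ x) = ξ (ρ r x) :=
    fun r x => mfderiv_flow_field hρ (hρaff r x).mdifferentiableAt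
  obtain ⟨θρ, hθρ⟩ := hdev.exists_affineAction ρ hρaff
  have hρg := hdev.inner_flow hM hρ hθρ
  -- The product action exists because elements of `G` preserve `ξ` and so commute with its flow.
  let Φ : Multiplicative ℝ × affineIsometryGroup g ξ →* Equiv.Perm M :=
    MonoidHom.noncommCoprod ρ (affineIsometryGroup g ξ).subtype fun r a => Equiv.ext fun x =>
      (flow_comm hM.smooth hρ (hX a.2) a.2.field r x).symm
  have hΦ : ∀ r (a : affineIsometryGroup g ξ) x, Φ (r, a) x = ρ r ((a : Equiv.Perm M) x) :=
    fun r a x => rfl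
  have hΦd : ∀ r (a : affineIsometryGroup g ξ) x (v : TangentSpace 𝓘(ℝ, RSpace n) x),
      mfderiv 𝓘(ℝ, RSpace n) 𝓘(ℝ, RSpace n) (Φ (r, a)) x v
        = mfderiv 𝓘(ℝ, RSpace n) 𝓘(ℝ, RSpace n) (ρ r) ((a : Equiv.Perm M) x)
          (mfderiv 𝓘(ℝ, RSpace n) 𝓘(ℝ, RSpace n) (a : Equiv.Perm M) x v) := fun r a x v =>
    congrArg (fun L : TangentSpace 𝓘(ℝ, RSpace n) x →L[ℝ] RSpace n => L v)
      (mfderiv_comp x (hρaff r _).mdifferentiableAt (hX a.2 x))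
  have hΦaff : ∀ k x, IsAffineMapAt n (Φ k) x := fun k x =>
    (hρaff k.1 _).comp (k.2.2.affine x)
  obtain ⟨Θ, hΘ⟩ := hdev.exists_affineAction Φ hΦaff
  have hinv : IsInvariantStructure (prodModel n) (psi Φ Θ) (complexI dev) (omegaCK g ξ dev) := by
    -- The scaling factor comes from the flow component alone.
    refine hdev.isInvariantStructure hΦaff hΘ (c := fun k => Real.exp (2 * k.1.toAdd))
      (fun k => (Real.exp_pos _).ne') ?_ ?_
    · rintro ⟨r, a⟩ x v w
      rw [hΦd, hΦd]
      exact (hρg r _ _ _).trans (congrArg _ (a.2.isometry x v w))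
    · rintro ⟨r, a⟩ x
      rw [hΦd, a.2.field]
      exact hρξ r _
  refine ⟨ρ, Φ, Θ, hρ, hΦ, hΘ, hinv, fun htrans => ⟨hck, hinv, ?_⟩⟩
  have hnorm : ∀ x, ∃ r : Multiplicative ℝ, g.inner (ρ r x) (ξ (ρ r x)) (ξ (ρ r x)) = 1 := by
    intro x
    have hpos : 0 < g.inner x (ξ x) (ξ x) := g.pos x _ (hξ x)
    -- The flow multiplies `g(ξ, ξ)` by `e^{2t}`, so this time normalizes it to `1`.
    refine ⟨Multiplicative.ofAdd (-Real.log (g.inner x (ξ x) (ξ x)) / 2), ?_⟩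
    rw [← hρξ, hρg, toAdd_ofAdd, mul_div_cancel₀ _ two_ne_zero, Real.exp_neg,
      Real.exp_log hpos, inv_mul_cancel₀ hpos.ne']
  rintro ⟨x, v⟩ ⟨y, w⟩
  obtain ⟨r, hr⟩ := hnorm x
  obtain ⟨s, hs⟩ := hnorm y
  obtain ⟨a, ha⟩ := htrans _ _ hr hs
  -- Flow `x` to the hypersurface `g(ξ, ξ) = 1`, move along it by `a`, and flow back to `y`;
  -- commutation collects the two flow times.
  have hk : Φ (s⁻¹ * r, a) x = y := by
    rw [hΦ, map_mul, map_inv, Equiv.Perm.mul_apply,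
      ← flow_comm hM.smooth hρ (hX a.2) a.2.field, ha]
    exact (ρ s).symm_apply_apply y
  -- The translation corrects the fibre coordinate once the base points agree.
  refine ⟨⟨Multiplicative.ofAdd (w - Θ (s⁻¹ * r, a) v), (s⁻¹ * r, a)⟩, Prod.ext hk ?_⟩
  exact add_sub_cancel _ w
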